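/- Let $G$ be a connected non-compact simple real Lie group with Lie algebra $\mathfrak g$ and Killing form $B$, and let $K$ be a maximal compact subgroup of $G$ with Lie algebra $\mathfrak k$. Let $\mathfrak p$ be the $B$-orthogonal complement of $\mathfrak k$ in $\mathfrak g$, so that $\mathfrak g=\mathfrak p\oplus\mathfrak k$, and let $Q=B|_{\mathfrak p}-B|_{\mathfrak k}$, that is, $Q(X,Y)=B(X_{\mathfrak p},Y_{\mathfrak p})-B(X_{\mathfrak k},Y_{\mathfrak k})$. Let $\mathfrak k_1,\dots,\mathfrak k_{r}$ be the simple ideals of $[\mathfrak k,\mathfrak k]$; if the centre of $\mathfrak k$ is non-trivial, denote it by $\mathfrak k_{r+1}$ and put $s=1$, and otherwise put $s=0$; thus $\mathfrak k=\mathfrak k_1\oplus\dots\oplus\mathfrak k_{r+s}$. Put $n=\dim\mathfrak p$ and $d_i=\dim\mathfrak k_i$, and let $\kappa_i\in\mathbb R$ be the constant such that the Killing form $B_i$ of $\mathfrak k_i$ satisfies $B_i=\kappa_iB|_{\mathfrak k_i}$. Identify left-invariant $(0,2)$-tensor fields on $G$ with bilinear forms on $\mathfrak g$. Suppose that $g$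 is a left-invariant Riemannian metric on $G$ of the form $$g=\beta Q|_{\mathfrak p}+\alpha_1Q|_{\mathfrak k_1}+\dots+\alpha_{r+s}Q|_{\mathfrak k_{r+s}},\qquad \beta,\alpha_1,\dots,\alpha_{r+s}>0,$$ where the subspaces $\mathfrak p,\mathfrak k_1,\dots,\mathfrak k_{r+s}$ are pairwise $g$-orthogonal. Then the Ricci curvature of $g$ is given by $$\operatorname{Ric}(g)|_{\mathfrak p}=-\sum_{i=1}^{r+s}\Big(\frac{\alpha_i}{2\beta}+1\Big)\frac{d_i(1-\kappa_i)}{n}\,Q|_{\mathfrak p},$$ $$\operatorname{Ric}(g)|_{\mathfrak k_j}=\frac14\Big(\frac{\alpha_j^2}{\beta^2}(1-\kappa_j)+\kappa_j\Big)Q|_{\mathfrak k_j},\qquad j=1,\dots,r+s,$$ $$\operatorname{Ric}(g)(\mathfrak p,\mathfrak k_j)=\operatorname{Ric}(g)(\mathfrak k_j,\mathfrak k_k)=0,\qquad j,k=1,\dots,r+s,\ j\neq k.$$ -/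

import Mathlib

open scoped Manifold ContDiff

noncomputable section

namespace RicciNatRed

/-! ### Lie algebra part: the form `Q`, the ideals `𝔨ᵢ` and the constants `κᵢ` -/

section Algebra

variable {L : Type*} [LieRing L] [LieAlgebra ℝ L]

/-- The orthogonal complement `𝔭` of a subalgebra `𝔨` with respect to the Killing form `B`. -/
def killingPerp (𝔨 : LieSubalgebra ℝ L) : Submodule ℝ L :=
  (killingForm ℝ L).orthogonal 𝔨.toSubmodule

open Classical in
/-- The bilinear form `Q = B|_𝔭 - B|_𝔨`, that is
`Q (X, Y) = B (X_𝔭, Y_𝔭) - B (X_𝔨, Y_𝔨)` for the decomposition `L = 𝔭 ⊕ 𝔨`.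
(If `𝔭` and `𝔨` are not complementary the value is `0`; this does not happen for the Lie
algebra `𝔨` of a compact subgroup of a simple group, since `B` is negative definite on it.) -/
def formQ (𝔨 : LieSubalgebra ℝ L) : LinearMap.BilinForm ℝ L :=
  if h : IsCompl (killingPerp 𝔨) 𝔨.toSubmodule then
    (killingForm ℝ L).compl₁₂
        ((killingPerp 𝔨).projection 𝔨.toSubmodule h)
        ((killingPerp 𝔨).projection 𝔨.toSubmodule h)
      - (killingForm ℝ L).compl₁₂
        (𝔨.toSubmodule.projection (killingPerp 𝔨) h.symm)
        (𝔨.toSubmodule.projection (killingPerp 𝔨) h.symm)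
  else 0

/-- `I` is one of the summands of `𝔨`: a simple ideal of `[𝔨, 𝔨]`, or the centre of `𝔨` when
the centre is non-trivial. (A simple ideal `I` of `[𝔨, 𝔨]` is automatically an ideal of `𝔨`,
because `I = [I, I]`.) -/
def IsSummand (𝔨 : LieSubalgebra ℝ L) (I : LieIdeal ℝ 𝔨) : Prop :=
  (I ≤ ⁅(⊤ : LieIdeal ℝ 𝔨), (⊤ : LieIdeal ℝ 𝔨)⁆ ∧ LieAlgebra.IsSimple ℝ I) ∨
    (I = LieAlgebra.center ℝ 𝔨 ∧ LieAlgebra.center ℝ 𝔨 ≠ ⊥)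

/-- An ideal of `𝔨`, viewed as a linear subspace of the ambient Lie algebra. -/
def ambient {𝔨 : LieSubalgebra ℝ L} (I : LieIdeal ℝ 𝔨) : Submodule ℝ L :=
  I.toSubmodule.map 𝔨.toSubmodule.subtype

open Classical in
/-- The constant `κ` with `B_I = κ B|_I`, where `B_I` is the Killing form of the Lie algebra `I`
and `B` is the Killing form of the ambient Lie algebra (and `0` if there is no such constant). -/
def kappa {𝔨 : LieSubalgebra ℝ L} (I : LieIdeal ℝ 𝔨) : ℝ :=
  if h : ∃ c : ℝ, ∀ x y : I,
      killingForm ℝ I x y = c * killingForm ℝ L ((x : 𝔨) : L) ((y : 𝔨) : L) then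
    h.choose
  else 0

end Algebra

/-! ### Levi-Civita connection and curvature -/

section Manifold

variable {E : Type*} [NormedAddCommGroup E] [NormedSpace ℝ E] [FiniteDimensional ℝ E]
  {M : Type*} [TopologicalSpace M] [ChartedSpace E M] [IsManifold 𝓘(ℝ, E) ∞ M]

/-- Smooth Riemannian metrics on the manifold `M`. -/
abbrev Metric (E : Type*) [NormedAddCommGroup E] [NormedSpace ℝ E]
    (M : Type*) [TopologicalSpace M] [ChartedSpace E M] [IsManifold 𝓘(ℝ, E) ∞ M] : Type _ :=
  Bundle.ContMDiffRiemannianMetric 𝓘(ℝ, E) ∞ E (fun x : M => TangentSpace 𝓘(ℝ, E) x)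

/-- Connections on the tangent bundle of `M`; `cov Y x v` is `(∇_v Y) (x)`. -/
abbrev Connection (E : Type*) [NormedAddCommGroup E] [NormedSpace ℝ E]
    (M : Type*) [TopologicalSpace M] [ChartedSpace E M] [IsManifold 𝓘(ℝ, E) ∞ M] : Type _ :=
  CovariantDerivative 𝓘(ℝ, E) E (fun x : M => TangentSpace 𝓘(ℝ, E) x)

/-- `cov` is the Levi-Civita connection of `g`: it is torsion-free, and it is metric,
`v (g (Y, Z)) = g (∇_v Y, Z) + g (Y, ∇_v Z)`. -/
structure IsLeviCivita (g : Metric E M) (cov : Connection E M) : Prop where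
  torsion_eq_zero : cov.torsion = 0
  metric : ∀ (Y Z : ∀ x : M, TangentSpace 𝓘(ℝ, E) x) (x : M),
    MDifferentiableAt 𝓘(ℝ, E) (𝓘(ℝ, E).prod 𝓘(ℝ, E))
      (fun y => Bundle.TotalSpace.mk' E y (Y y)) x →
    MDifferentiableAt 𝓘(ℝ, E) (𝓘(ℝ, E).prod 𝓘(ℝ, E))
      (fun y => Bundle.TotalSpace.mk' E y (Z y)) x →
    ∀ v : TangentSpace 𝓘(ℝ, E) x,
      mvfderiv 𝓘(ℝ, E) (fun y => g.inner y (Y y) (Z y)) x v =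
        g.inner x (cov Y x v) (Z x) + g.inner x (Y x) (cov Z x v)

/-- The curvature `R(X, Y)Z = ∇_X ∇_Y Z - ∇_Y ∇_X Z - ∇_[X, Y] Z`, at the point `x`. -/
def curvature (cov : Connection E M) (X Y Z : ∀ x : M, TangentSpace 𝓘(ℝ, E) x) (x : M) :
    TangentSpace 𝓘(ℝ, E) x :=
  cov (fun y => cov Z y (Y y)) x (X x) - cov (fun y => cov Z y (X y)) x (Y x)
    - cov Z x (VectorField.mlieBracket 𝓘(ℝ, E) X Y x)

end Manifold

/-! ### Lie groups -/

section Group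

variable {E : Type*} [NormedAddCommGroup E] [NormedSpace ℝ E] [FiniteDimensional ℝ E]
  {G : Type*} [TopologicalSpace G] [ChartedSpace E G] [Group G]

/-- A smooth real Lie group has the regularity for which Mathlib builds its Lie algebra. -/
instance instLieGroupMinSmoothness [LieGroup 𝓘(ℝ, E) ∞ G] :
    LieGroup 𝓘(ℝ, E) (minSmoothness ℝ 3) G := by
  rw [minSmoothness_of_isRCLikeNormedField]
  infer_instance

/-- The set of all `X` in the Lie algebra of `G` with `exp (tX) ∈ K` for all real `t`, where
`t ↦ exp (tX)` is the integral curve through `1` of the left-invariant vector field of `X`.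
For a closed subgroup `K` this is the Lie algebra of `K`. -/
def lieAlgebraSet (E : Type*) [NormedAddCommGroup E] [NormedSpace ℝ E]
    {G : Type*} [TopologicalSpace G] [ChartedSpace E G] [Group G] (K : Subgroup G) :
    Set (GroupLieAlgebra 𝓘(ℝ, E) G) :=
  {X | ∃ γ : ℝ → G, γ 0 = 1 ∧ IsMIntegralCurve γ (mulInvariantVectorField X) ∧ ∀ t, γ t ∈ K}

instance instFiniteGroupLieAlgebra : Module.Finite ℝ (GroupLieAlgebra 𝓘(ℝ, E) G) :=
  inferInstanceAs (Module.Finite ℝ E)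

variable [LieGroup 𝓘(ℝ, E) ∞ G]

/-- The metric `g` is left-invariant. -/
def IsLeftInvariant (g : Metric E G) : Prop :=
  ∀ (x : G) (X Y : GroupLieAlgebra 𝓘(ℝ, E) G),
    g.inner x (mulInvariantVectorField X x) (mulInvariantVectorField Y x) = g.inner 1 X Y

/-- The Ricci tensor at the identity, `Ric (X, Y) = tr (Z ↦ R(Z, X)Y)`. The curvature being a
tensor, it may be evaluated on the left-invariant vector fields that extend `Z`, `X` and `Y`. -/
def ricci (cov : Connection E G) (X Y : GroupLieAlgebra 𝓘(ℝ, E) G) : ℝ :=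
  let b := Module.finBasis ℝ (GroupLieAlgebra 𝓘(ℝ, E) G)
  ∑ i, b.repr (curvature cov (mulInvariantVectorField (b i)) (mulInvariantVectorField X)
    (mulInvariantVectorField Y) (1 : G)) i

/-- The bilinear form induced by `g` on the Lie algebra is
`β Q|_𝔭 + ∑ᵢ αᵢ Q|_{𝔨ᵢ}`: its blocks on `𝔭` and on the `𝔨ᵢ` are the given multiples of `Q`, and
these subspaces are mutually orthogonal. -/
structure IsDiagonal (g : Metric E G) (𝔨 : LieSubalgebra ℝ (GroupLieAlgebra 𝓘(ℝ, E) G))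
    {ι : Type*} (𝔨i : ι → LieIdeal ℝ 𝔨) (β : ℝ) (α : ι → ℝ) : Prop where
  on_p : ∀ X ∈ killingPerp 𝔨, ∀ Y ∈ killingPerp 𝔨, g.inner 1 X Y = β * formQ 𝔨 X Y
  on_k : ∀ i, ∀ X ∈ ambient (𝔨i i), ∀ Y ∈ ambient (𝔨i i), g.inner 1 X Y = α i * formQ 𝔨 X Y
  p_k : ∀ i, ∀ X ∈ killingPerp 𝔨, ∀ Y ∈ ambient (𝔨i i), g.inner 1 X Y = 0
  k_k : ∀ i j, i ≠ j → ∀ X ∈ ambient (𝔨i i), ∀ Y ∈ ambient (𝔨i j), g.inner 1 X Y = 0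

end Group

end RicciNatRed

end

noncomputable section

namespace RicciNatRed

open LinearMap (trace)
open LieAlgebra (ad)

/-! A torsion-free metric product on a positive definite space is unique. Hence the Levi-Civita
connection of a left-invariant metric preserves left-invariant fields and is given by a product `V`
on the Lie algebra (`exists_leviCivita_algebraic`). Ricci becomes the trace of an endomorphism, and
the rest is linear algebra (`trace_curvature`).

The signs of `B` come from `g`. Since `g` is positive, so is `Q` on `𝔭` and on each `𝔨ᵢ`. This gives
`L = 𝔭 ⊕ 𝔨` with `B > 0` on `𝔭`. Then `B < 0` on all of `𝔨`, because `ad k` is skew on `𝔭` and on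
`𝔨` for suitable definite forms. These signs and `[𝔨, 𝔨] ⊆ 𝔨` already force the Cartan relation `[𝔭,
𝔭] ⊆ 𝔨` (`KillingFrame.P_lie_p_p`). The proof shows that a cubic trace in the compressions `T u = P
(ad u) P` is both nonpositive and nonnegative, by `tr F² ≤ 0` for skew `F` on `𝔭`.

Let `M` act on `𝔨ᵢ` by `αᵢ / (2β)` and vanish on `𝔭`. Then `g = β (B(P·, P·) - 2 B(M·, ·))`, and its
connection is the explicit product `U`. Tracing its curvature gives `-tr ((K + M) ad y ad x)` on `𝔭`
and `-tr_𝔭 (ad Mk ad Ml) - tr_𝔨 (ad k ad l) / 4` on `𝔨`. The mixed blocks vanish by parity.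

The traces over `𝔨` are Killing forms of the ideals, which bring in `κᵢ`. On `𝔭`, simplicity of `L`
makes `𝔭` irreducible under `𝔨`. By Schur's argument each `tr (projᵢ ad y ad x)` is a multiple of
`B`, and contraction with a frame identifies the multiple as `dᵢ (1 - κᵢ) / n`. -/

theorem eq_zero_of_symm_of_skew {V : Type*} [AddCommGroup V] [Module ℝ V]
    (g : LinearMap.BilinForm ℝ V) (hs : ∀ x y, g x y = g y x) (hp : ∀ x, x ≠ 0 → 0 < g x x)
    (D : V → V → V) (hD : ∀ x y, D x y = D y x) (hg : ∀ x y z, g (D x y) z = - g y (D x z))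
    (x y : V) : D x y = 0 := by
  -- The trilinear expression is symmetric in its first two slots and skew in its last two. Going
  -- once around the permutations turns it into its own negative, as in the Koszul formula.
  have key : ∀ x y z, g (D x y) z = 0 := by
    intro x y z
    have h1 := hg x y z
    have h2 := hg z x y
    have h3 := hg y z x
    rw [hs y] at h1; rw [hs x] at h2; rw [hs z] at h3
    rw [hD y z] at h3; rw [hD y x] at h3; rw [hD x z] at h1
    linarith
  by_contra h
  exact (hp _ h).ne' (key _ _ _)

/-! ### Left-invariant fields: reduction of the connection and of Ricci to the Lie algebra -/

section
variable {E : Type*} [NormedAddCommGroup E] [NormedSpace ℝ E] [FiniteDimensional ℝ E]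
  {G : Type*} [TopologicalSpace G] [ChartedSpace E G] [Group G] [LieGroup 𝓘(ℝ, E) ∞ G]

/-- The bilinear form on the Lie algebra induced by a metric on the group. -/
def metricForm (g : Metric E G) : LinearMap.BilinForm ℝ (GroupLieAlgebra 𝓘(ℝ, E) G) :=
  LinearMap.mk₂ ℝ (fun X Y => g.inner 1 X Y) (by simp) (by simp) (by simp) (by simp)

omit [FiniteDimensional ℝ E] in
theorem metricForm_apply (g : Metric E G) (X Y : GroupLieAlgebra 𝓘(ℝ, E) G) :
    metricForm g X Y = g.inner 1 X Y := rfl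

/-- Left translation, as a linear map from the Lie algebra to the tangent space at `x`. -/
def leftTranslation (x : G) : GroupLieAlgebra 𝓘(ℝ, E) G →ₗ[ℝ] TangentSpace 𝓘(ℝ, E) x where
  toFun v := mulInvariantVectorField v x
  map_add' v w := by rw [mulInvariantVectorField_add]; rfl
  map_smul' c v := by rw [mulInvariantVectorField_smul]; rfl

omit [FiniteDimensional ℝ E] [LieGroup 𝓘(ℝ, E) ∞ G] in
theorem leftTranslation_apply (x : G) (v : GroupLieAlgebra 𝓘(ℝ, E) G) :
    leftTranslation x v = mulInvariantVectorField v x := rfl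

omit [FiniteDimensional ℝ E] [LieGroup 𝓘(ℝ, E) ∞ G] in
theorem leftTranslation_one (v : GroupLieAlgebra 𝓘(ℝ, E) G) :
    mulInvariantVectorField v (1 : G) = v := by
  simp only [mulInvariantVectorField]
  have : (fun x : G => 1 * x) = id := by ext; simp
  rw [this, mfderiv_id]; rfl

theorem exists_leftTranslation_eq (x : G) (w : TangentSpace 𝓘(ℝ, E) x)
    (g : Metric E G) (hg : IsLeftInvariant g) :
    ∃ v : GroupLieAlgebra 𝓘(ℝ, E) G, mulInvariantVectorField v x = w := by
  have hinj : Function.Injective (leftTranslation (E := E) x) := by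
    rw [injective_iff_map_eq_zero]
    intro v hv
    by_contra h
    have h1 := g.pos 1 v h
    have h2 := hg x v v
    rw [← leftTranslation_apply, hv] at h2
    simp only [map_zero] at h2
    exact h1.ne h2
  -- Every tangent space is `E` by definition, so left translation may be read as an endomorphism,
  -- for which injective means surjective.
  let f : GroupLieAlgebra 𝓘(ℝ, E) G →ₗ[ℝ] GroupLieAlgebra 𝓘(ℝ, E) G :=
    leftTranslation (E := E) x
  exact (LinearMap.injective_iff_surjective (f := f)).1 hinj w

/-- Translating `∇_X Y` at `x` back to the identity gives a product `W x`. Inner products of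
left-invariant fields are constant, so each `W x` is metric as well as torsion-free. By uniqueness
`W x = W 1`, that is, `∇_X Y` is left-invariant. -/
theorem exists_leviCivita_algebraic (g : Metric E G) (hg : IsLeftInvariant g)
    (cov : Connection E G) (hcov : IsLeviCivita g cov) :
    ∃ V : GroupLieAlgebra 𝓘(ℝ, E) G → GroupLieAlgebra 𝓘(ℝ, E) G → GroupLieAlgebra 𝓘(ℝ, E) G,
      (∀ X Y x, cov (mulInvariantVectorField Y) x (mulInvariantVectorField X x) =
        mulInvariantVectorField (V X Y) x) ∧
      (∀ X Y, V X Y - V Y X = ⁅X, Y⁆) ∧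
      ∀ X Y Z, metricForm g (V X Y) Z = - metricForm g Y (V X Z) := by
  choose W hW using fun (x : G) (X Y : GroupLieAlgebra 𝓘(ℝ, E) G) =>
    exists_leftTranslation_eq x (cov (mulInvariantVectorField Y) x (mulInvariantVectorField X x)) g hg
  have hinj : ∀ x : G, Function.Injective (leftTranslation (E := E) x) := by
    intro x
    rw [injective_iff_map_eq_zero]
    intro v hv
    by_contra h
    have h1 := g.pos 1 v h
    have h2 := hg x v v
    rw [← leftTranslation_apply, hv] at h2
    simp only [map_zero] at h2
    exact h1.ne h2
  have htor : ∀ x X Y, W x X Y - W x Y X = ⁅X, Y⁆ := by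
    intro x X Y
    apply hinj x
    rw [map_sub, leftTranslation_apply, leftTranslation_apply, leftTranslation_apply, hW, hW,
      GroupLieAlgebra.bracket_def, mulInvariantVector_mlieBracket]
    exact cov.torsion_eq_zero_iff.1 hcov.torsion_eq_zero
      (mdifferentiableAt_mulInvariantVectorField X) (mdifferentiableAt_mulInvariantVectorField Y)
  have hskew : ∀ x X Y Z, metricForm g (W x X Y) Z = - metricForm g Y (W x X Z) := by
    intro x X Y Z
    have h := hcov.metric (mulInvariantVectorField Y) (mulInvariantVectorField Z) x
      (mdifferentiableAt_mulInvariantVectorField Y) (mdifferentiableAt_mulInvariantVectorField Z)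
      (mulInvariantVectorField X x)
    have hc : (fun y => g.inner y (mulInvariantVectorField Y y) (mulInvariantVectorField Z y)) =
        fun _ => g.inner 1 Y Z := by
      ext y; exact hg y Y Z
    rw [hc, ← hW, ← hW, hg, hg] at h
    have h0 : mvfderiv 𝓘(ℝ, E) (fun _ : G => g.inner 1 Y Z) x (mulInvariantVectorField X x) = 0 := by
      simp [mvfderiv, mfderiv_const]
    rw [h0] at h
    rw [metricForm_apply, metricForm_apply]
    linarith
  refine ⟨W 1, ?_, htor 1, hskew 1⟩
  intro X Y x
  rw [← hW x X Y]
  congr 1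
  have := eq_zero_of_symm_of_skew (metricForm g) (fun a b => g.symm 1 a b) (fun a ha => g.pos 1 a ha)
    (fun A B => W x A B - W 1 A B)
    (fun A B => by
      have h1 := htor x A B
      have h2 := htor 1 A B
      rw [sub_eq_sub_iff_sub_eq_sub, h1, h2])
    (fun A B C => by
      simp only [map_sub, LinearMap.sub_apply, hskew]; ring) X Y
  exact sub_eq_zero.1 this

theorem ricci_eq_sum (cov : Connection E G)
    (V : GroupLieAlgebra 𝓘(ℝ, E) G → GroupLieAlgebra 𝓘(ℝ, E) G → GroupLieAlgebra 𝓘(ℝ, E) G)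
    (hV : ∀ X Y x, cov (mulInvariantVectorField Y) x (mulInvariantVectorField X x) =
        mulInvariantVectorField (V X Y) x) (X Y : GroupLieAlgebra 𝓘(ℝ, E) G) :
    ricci cov X Y = ∑ i, (Module.finBasis ℝ (GroupLieAlgebra 𝓘(ℝ, E) G)).repr
      (V (Module.finBasis ℝ (GroupLieAlgebra 𝓘(ℝ, E) G) i) (V X Y)
        - V X (V (Module.finBasis ℝ (GroupLieAlgebra 𝓘(ℝ, E) G) i) Y)
        - V ⁅Module.finBasis ℝ (GroupLieAlgebra 𝓘(ℝ, E) G) i, X⁆ Y) i := by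
  simp only [ricci]
  refine Finset.sum_congr rfl fun i _ => ?_
  congr 2
  have hf : ∀ A B, (fun y => cov (mulInvariantVectorField B) y (mulInvariantVectorField A y)) =
      mulInvariantVectorField (V A B) := fun A B => by ext y; exact hV A B y
  rw [curvature, hf, hf, hV, hV, ← mulInvariantVector_mlieBracket, hV, leftTranslation_one,
    leftTranslation_one, leftTranslation_one]
  rfl

end

/-! ### Invariance of the Killing form, frames adapted to `𝔭 ⊕ 𝔨`, and traces -/

theorem killingForm_symm {L : Type*} [LieRing L] [LieAlgebra ℝ L] (x y : L) :
    killingForm ℝ L x y = killingForm ℝ L y x := LieModule.traceForm_comm ℝ L L x y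

theorem killingForm_lie {L : Type*} [LieRing L] [LieAlgebra ℝ L] (x y z : L) :
    killingForm ℝ L ⁅x, y⁆ z = killingForm ℝ L x ⁅y, z⁆ :=
  LieModule.traceForm_apply_lie_apply ℝ L L x y z

theorem killingForm_lie' {L : Type*} [LieRing L] [LieAlgebra ℝ L] (x y z : L) :
    killingForm ℝ L ⁅x, y⁆ z = - killingForm ℝ L y ⁅x, z⁆ :=
  LieModule.traceForm_apply_lie_apply' ℝ L L x y z

/-- A basis of a Lie algebra adapted to a decomposition `L = 𝔭 ⊕ 𝔨` with `[𝔨, 𝔨] ⊆ 𝔨`, orthogonal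
for the Killing form, which is normalised to `1` on the vectors `e a` of `𝔭` and to `-1` on the
vectors `c i` of `𝔨`. -/
structure KillingFrame (L : Type*) [LieRing L] [LieAlgebra ℝ L] (n κ : Type*)
    [Fintype n] [Fintype κ] where
  e : n → L
  c : κ → L
  e_e_self : ∀ a, killingForm ℝ L (e a) (e a) = 1
  e_e : ∀ a b, a ≠ b → killingForm ℝ L (e a) (e b) = 0
  c_c_self : ∀ i, killingForm ℝ L (c i) (c i) = -1
  c_c : ∀ i j, i ≠ j → killingForm ℝ L (c i) (c j) = 0
  e_c : ∀ a i, killingForm ℝ L (e a) (c i) = 0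
  expand : ∀ u, u = ∑ a, killingForm ℝ L u (e a) • e a - ∑ i, killingForm ℝ L u (c i) • c i
  lie_c : ∀ i j a, killingForm ℝ L ⁅c i, c j⁆ (e a) = 0

namespace KillingFrame

variable {L : Type*} [LieRing L] [LieAlgebra ℝ L] {n κ : Type*} [Fintype n] [Fintype κ]
  (f : KillingFrame L n κ)

/-- The projection to `𝔭`. -/
def P : Module.End ℝ L := ∑ a, (killingForm ℝ L (f.e a)).smulRight (f.e a)

/-- The projection to `𝔨`. -/
def K : Module.End ℝ L := -∑ i, (killingForm ℝ L (f.c i)).smulRight (f.c i)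

theorem P_apply (u : L) : f.P u = ∑ a, killingForm ℝ L (f.e a) u • f.e a := by
  simp [P, LinearMap.sum_apply]

theorem K_apply (u : L) : f.K u = -∑ i, killingForm ℝ L (f.c i) u • f.c i := by
  simp [K, LinearMap.sum_apply]

theorem P_add_K : f.P + f.K = 1 := by
  ext u
  rw [LinearMap.add_apply, P_apply, K_apply]
  conv_rhs => rw [Module.End.one_apply, f.expand u]
  simp only [killingForm_symm u]
  abel

theorem P_apply_add_K_apply (u : L) : f.P u + f.K u = u := by
  rw [← LinearMap.add_apply, P_add_K, Module.End.one_apply]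

theorem P_e (a : n) : f.P (f.e a) = f.e a := by
  rw [P_apply, Finset.sum_eq_single a]
  · simp [f.e_e_self]
  · intro b _ h; simp [f.e_e b a h]
  · simp

theorem K_c (i : κ) : f.K (f.c i) = f.c i := by
  rw [K_apply, Finset.sum_eq_single i]
  · simp [f.c_c_self]
  · intro b _ h; simp [f.c_c b i h]
  · simp

theorem P_c (i : κ) : f.P (f.c i) = 0 := by simp [P_apply, f.e_c]

theorem K_e (a : n) : f.K (f.e a) = 0 := by
  simp [K_apply, killingForm_symm _ (f.e a), f.e_c]

theorem P_mul_P : f.P * f.P = f.P := by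
  ext u; simp [f.P_apply u, P_e]

theorem K_mul_K : f.K * f.K = f.K := by
  ext u; simp [f.K_apply u, K_c]

theorem P_mul_K : f.P * f.K = 0 := by
  ext u; simp [f.K_apply u, P_c]

theorem K_mul_P : f.K * f.P = 0 := by
  ext u; simp [f.P_apply u, K_e]

theorem P_P (u : L) : f.P (f.P u) = f.P u := LinearMap.congr_fun f.P_mul_P u
theorem K_K (u : L) : f.K (f.K u) = f.K u := LinearMap.congr_fun f.K_mul_K u
theorem P_K (u : L) : f.P (f.K u) = 0 := LinearMap.congr_fun f.P_mul_K u
theorem K_P (u : L) : f.K (f.P u) = 0 := LinearMap.congr_fun f.K_mul_P u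

theorem K_eq_zero {x : L} (hx : f.P x = x) : f.K x = 0 := by rw [← hx, K_P]
theorem P_eq_zero {x : L} (hx : f.K x = x) : f.P x = 0 := by rw [← hx, P_K]
theorem P_eq_self {x : L} (hx : f.K x = 0) : f.P x = x := by
  simpa [hx] using f.P_apply_add_K_apply x
theorem K_eq_self {x : L} (hx : f.P x = 0) : f.K x = x := by
  simpa [hx] using f.P_apply_add_K_apply x

theorem killingForm_P (u v : L) : killingForm ℝ L (f.P u) v = killingForm ℝ L u (f.P v) := by
  simp only [P_apply, map_sum, LinearMap.sum_apply, map_smul, LinearMap.smul_apply, smul_eq_mul]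
  exact Finset.sum_congr rfl fun a _ => by rw [killingForm_symm u]; ring

theorem killingForm_K (u v : L) : killingForm ℝ L (f.K u) v = killingForm ℝ L u (f.K v) := by
  simp only [K_apply, map_neg, LinearMap.neg_apply, map_sum, LinearMap.sum_apply, map_smul,
    LinearMap.smul_apply, smul_eq_mul]
  exact congrArg _ <| Finset.sum_congr rfl fun a _ => by rw [killingForm_symm u]; ring

theorem killingForm_K_P (u v : L) : killingForm ℝ L (f.K u) (f.P v) = 0 := by
  rw [killingForm_K, K_P, map_zero]

theorem killingForm_P_self (v : L) :
    killingForm ℝ L (f.P v) v = ∑ a, killingForm ℝ L (f.e a) v ^ 2 := by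
  simp [P_apply, sq]

theorem killingForm_self_nonneg {v : L} (hv : f.P v = v) : 0 ≤ killingForm ℝ L v v := by
  rw [← hv, f.killingForm_P, f.P_P, killingForm_symm, killingForm_P_self]; positivity

theorem eq_zero_of_killingForm_self_nonpos {v : L} (hv : f.P v = v)
    (h : killingForm ℝ L v v ≤ 0) : v = 0 := by
  have h1 := f.killingForm_P_self v
  rw [hv] at h1
  have h2 : ∑ a, killingForm ℝ L (f.e a) v ^ 2 = 0 :=
    le_antisymm (h1 ▸ h) (by positivity)
  rw [Finset.sum_eq_zero_iff_of_nonneg (fun _ _ => sq_nonneg _)] at h2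
  rw [← hv, P_apply]
  exact Finset.sum_eq_zero fun a _ => by rw [pow_eq_zero_iff two_ne_zero |>.1 (h2 a (by simp)), zero_smul]

theorem e_ext {u : L} (hu : f.P u = u) (h : ∀ a, killingForm ℝ L (f.e a) u = 0) : u = 0 := by
  rw [← hu, P_apply]; simp [h]

section trace
variable [Module.Finite ℝ L]

theorem trace_mul_P (F : Module.End ℝ L) :
    trace ℝ L (F * f.P) = ∑ a, killingForm ℝ L (F (f.e a)) (f.e a) := by
  have : F * f.P = ∑ a, (killingForm ℝ L (f.e a)).smulRight (F (f.e a)) := by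
    ext u; simp [P_apply]
  rw [this, map_sum]
  exact Finset.sum_congr rfl fun a _ => by rw [LinearMap.trace_smulRight, killingForm_symm]

theorem trace_mul_K (F : Module.End ℝ L) :
    trace ℝ L (F * f.K) = -∑ i, killingForm ℝ L (F (f.c i)) (f.c i) := by
  have : F * f.K = -∑ i, (killingForm ℝ L (f.c i)).smulRight (F (f.c i)) := by
    ext u; simp [K_apply]
  rw [this, map_neg, map_sum]
  exact congrArg _ <|
    Finset.sum_congr rfl fun a _ => by rw [LinearMap.trace_smulRight, killingForm_symm]

omit [Module.Finite ℝ L] in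
theorem trace_eq (F : Module.End ℝ L) :
    trace ℝ L F = trace ℝ L (F * f.P) + trace ℝ L (F * f.K) := by
  rw [← map_add, ← mul_add, P_add_K, mul_one]

include f in
-- In a `B`-orthonormal frame the trace is a signed sum of diagonal entries, and these agree for an
-- operator and its `B`-adjoint. This is the source of the trace symmetries below.
theorem trace_eq_of_adjoint {F G : Module.End ℝ L}
    (h : ∀ u v, killingForm ℝ L (F u) v = killingForm ℝ L u (G v)) :
    trace ℝ L F = trace ℝ L G := by
  rw [f.trace_eq, f.trace_eq G, trace_mul_P, trace_mul_P, trace_mul_K, trace_mul_K]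
  simp only [h, killingForm_symm (G _)]

theorem trace_mul_self_eq {F : Module.End ℝ L} (hF : F * f.P = F)
    (h : ∀ u v, killingForm ℝ L (F u) v = - killingForm ℝ L u (F v)) :
    trace ℝ L (F * F) = -∑ a, killingForm ℝ L (F (f.e a)) (F (f.e a)) := by
  rw [← hF, ← mul_assoc, trace_mul_P, hF, ← Finset.sum_neg_distrib]
  exact Finset.sum_congr rfl fun a _ => by rw [Module.End.mul_apply, h]

/-- For a skew operator living on `𝔭`, `-tr F²` is a sum of squared lengths `B(F e, F e)`, and `B`
is positive on `𝔭`. -/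
theorem trace_mul_self_nonpos {F : Module.End ℝ L} (hF : F * f.P = F) (hF' : f.P * F = F)
    (h : ∀ u v, killingForm ℝ L (F u) v = - killingForm ℝ L u (F v)) :
    trace ℝ L (F * F) ≤ 0 := by
  rw [f.trace_mul_self_eq hF h, neg_nonpos]
  exact Finset.sum_nonneg fun a _ => f.killingForm_self_nonneg (LinearMap.congr_fun hF' _)

theorem eq_zero_of_trace_mul_self_nonneg {F : Module.End ℝ L} (hF : F * f.P = F)
    (hF' : f.P * F = F) (h : ∀ u v, killingForm ℝ L (F u) v = - killingForm ℝ L u (F v))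
    (h0 : 0 ≤ trace ℝ L (F * F)) : F = 0 := by
  have h1 : ∀ a, 0 ≤ killingForm ℝ L (F (f.e a)) (F (f.e a)) :=
    fun a => f.killingForm_self_nonneg (LinearMap.congr_fun hF' _)
  have h2 : ∑ a, killingForm ℝ L (F (f.e a)) (F (f.e a)) = 0 := by
    have := f.trace_mul_self_eq hF h
    exact le_antisymm (by linarith) (Finset.sum_nonneg fun a _ => h1 a)
  rw [Finset.sum_eq_zero_iff_of_nonneg (fun a _ => h1 a)] at h2
  rw [← hF]
  ext u
  rw [Module.End.mul_apply, P_apply, map_sum]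
  refine Finset.sum_eq_zero fun a _ => ?_
  rw [map_smul, f.eq_zero_of_killingForm_self_nonpos (LinearMap.congr_fun hF' _) (h2 a (by simp)).le, smul_zero]

end trace

/-! #### Brackets -/

theorem P_lie_c_c (i j : κ) : f.P ⁅f.c i, f.c j⁆ = 0 := by
  rw [P_apply]
  exact Finset.sum_eq_zero fun a _ => by rw [killingForm_symm, f.lie_c, zero_smul]

theorem P_lie_K_K (u v : L) : f.P ⁅f.K u, f.K v⁆ = 0 := by
  rw [K_apply, K_apply, neg_lie, lie_neg, neg_neg, sum_lie, map_sum]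
  refine Finset.sum_eq_zero fun i _ => ?_
  rw [lie_sum, map_sum]
  refine Finset.sum_eq_zero fun j _ => ?_
  rw [smul_lie, lie_smul, map_smul, map_smul, P_lie_c_c, smul_zero, smul_zero]

theorem K_lie_K_P (u v : L) : f.K ⁅f.K u, f.P v⁆ = 0 := by
  rw [K_apply, neg_eq_zero]
  refine Finset.sum_eq_zero fun i _ => ?_
  have : killingForm ℝ L (f.c i) ⁅f.K u, f.P v⁆ = 0 := by
    rw [← killingForm_lie, ← killingForm_P, ← f.K_c i, P_lie_K_K]; simp
  rw [this, zero_smul]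

theorem P_lie_k_k {k l : L} (hk : f.K k = k) (hl : f.K l = l) : f.P ⁅k, l⁆ = 0 := by
  rw [← hk, ← hl, P_lie_K_K]

theorem K_lie_k_k {k l : L} (hk : f.K k = k) (hl : f.K l = l) : f.K ⁅k, l⁆ = ⁅k, l⁆ :=
  f.K_eq_self (f.P_lie_k_k hk hl)

theorem K_lie_k_p {k x : L} (hk : f.K k = k) (hx : f.P x = x) : f.K ⁅k, x⁆ = 0 := by
  rw [← hk, ← hx, K_lie_K_P]

theorem P_lie_k_p {k x : L} (hk : f.K k = k) (hx : f.P x = x) : f.P ⁅k, x⁆ = ⁅k, x⁆ :=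
  f.P_eq_self (f.K_lie_k_p hk hx)

theorem P_lie_p_k {k x : L} (hx : f.P x = x) (hk : f.K k = k) : f.P ⁅x, k⁆ = ⁅x, k⁆ := by
  rw [← lie_skew, map_neg, f.P_lie_k_p hk hx]

theorem K_lie_p_k {k x : L} (hx : f.P x = x) (hk : f.K k = k) : f.K ⁅x, k⁆ = 0 := by
  rw [← lie_skew, map_neg, f.K_lie_k_p hk hx, neg_zero]

theorem P_mul_ad {k : L} (hk : f.K k = k) : f.P * ad ℝ L k = ad ℝ L k * f.P := by
  ext u
  conv_lhs => rw [← f.P_apply_add_K_apply u]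
  simp [f.P_lie_k_p hk (f.P_P u), f.P_lie_k_k hk (f.K_K u)]

theorem K_mul_ad {k : L} (hk : f.K k = k) : f.K * ad ℝ L k = ad ℝ L k * f.K := by
  ext u
  conv_lhs => rw [← f.P_apply_add_K_apply u]
  simp [f.K_lie_k_p hk (f.P_P u), f.K_lie_k_k hk (f.K_K u)]

theorem K_ad_K {x : L} (hx : f.P x = x) : f.K * ad ℝ L x * f.K = 0 := by
  ext u
  simp [f.K_lie_p_k hx (f.K_K u)]

end KillingFrame

/-! ### The compression `T` of `ad` to `𝔭`, and the Cartan relation `[𝔭, 𝔭] ⊆ 𝔨` -/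

theorem ad_lie {L : Type*} [LieRing L] [LieAlgebra ℝ L] (x y : L) :
    ad ℝ L ⁅x, y⁆ = ad ℝ L x * ad ℝ L y - ad ℝ L y * ad ℝ L x := by
  ext u; simp

namespace KillingFrame

variable {L : Type*} [LieRing L] [LieAlgebra ℝ L] {n κ : Type*} [Fintype n] [Fintype κ]
  (f : KillingFrame L n κ)

/-- The compression of `ad u` to `𝔭`. -/
def T : L →ₗ[ℝ] Module.End ℝ L where
  toFun u := f.P * ad ℝ L u * f.P
  map_add' u v := by ext w; simp
  map_smul' r u := by ext w; simp

theorem T_eq (u : L) : f.T u = f.P * ad ℝ L u * f.P := rfl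

theorem T_apply (u v : L) : f.T u v = f.P ⁅u, f.P v⁆ := rfl

theorem T_mul_P (u : L) : f.T u * f.P = f.T u := by rw [T_eq, mul_assoc, P_mul_P]

theorem P_mul_T (u : L) : f.P * f.T u = f.T u := by rw [T_eq, mul_assoc, ← mul_assoc, P_mul_P]

theorem P_T_apply (u v : L) : f.P (f.T u v) = f.T u v := LinearMap.congr_fun (f.P_mul_T u) v

theorem T_skew (w u v : L) :
    killingForm ℝ L (f.T w u) v = - killingForm ℝ L u (f.T w v) := by
  rw [T_apply, T_apply, killingForm_P, killingForm_lie', killingForm_P]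

theorem T_of_mem {c : L} (hc : f.K c = c) : f.T c = ad ℝ L c * f.P := by
  rw [T_eq, P_mul_ad f hc, mul_assoc, P_mul_P]

theorem T_comm {x y : L} (hx : f.P x = x) (hy : f.P y = y) : f.T x y = - f.T y x := by
  rw [T_apply, T_apply, hx, hy, ← lie_skew, map_neg]

theorem T_lie {c x : L} (hc : f.K c = c) :
    f.T ⁅c, x⁆ = f.T c * f.T x - f.T x * f.T c := by
  have h := f.P_mul_ad hc
  rw [f.T_of_mem hc, T_eq, T_eq, ad_lie]
  have h1 : f.P * ad ℝ L x * f.P * (ad ℝ L c * f.P) = f.P * ad ℝ L x * (ad ℝ L c * f.P) := by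
    rw [← h, ← mul_assoc, mul_assoc _ f.P f.P, P_mul_P, mul_assoc, h, ← mul_assoc]
  have h2 : ad ℝ L c * f.P * (f.P * ad ℝ L x * f.P) = f.P * ad ℝ L c * (ad ℝ L x * f.P) := by
    rw [h, mul_assoc, ← mul_assoc f.P (f.P * _), ← mul_assoc f.P f.P, P_mul_P]
    simp only [mul_assoc]
  rw [h1, h2]
  noncomm_ring

section trace
variable [Module.Finite ℝ L]

/-- This is `B(c, w) = 0` written as a trace. The `𝔨`-block contributes nothing, since `ad c`
preserves `𝔨` while `ad w` maps `𝔨` into `𝔭`. -/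
theorem trace_T_mul_T {c w : L} (hc : f.K c = c) (hw : f.P w = w) :
    trace ℝ L (f.T c * f.T w) = 0 := by
  have h : killingForm ℝ L c w = 0 := by rw [← hc, ← hw, killingForm_K_P]
  rw [killingForm_apply_apply, ← Module.End.mul_eq_comp, f.trace_eq] at h
  have hK : trace ℝ L (ad ℝ L c * ad ℝ L w * f.K) = 0 := by
    rw [← f.K_mul_K, ← mul_assoc, LinearMap.trace_mul_comm, ← mul_assoc, ← mul_assoc,
      f.K_mul_ad hc, mul_assoc, mul_assoc, ← mul_assoc f.K, f.K_ad_K hw, mul_zero, map_zero]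
  rw [hK, add_zero] at h
  rw [f.T_of_mem hc, T_eq, ← h]
  conv_rhs => rw [← f.P_mul_P, ← mul_assoc, LinearMap.trace_mul_comm, ← mul_assoc, ← mul_assoc,
    f.P_mul_ad hc]
  rw [← mul_assoc, ← mul_assoc, mul_assoc _ f.P f.P, f.P_mul_P]

/-- The adjoint of a product of three skew operators is minus the reversed product. -/
theorem trace_T_mul_T_mul_T (u v w : L) :
    trace ℝ L (f.T u * f.T v * f.T w) = - trace ℝ L (f.T w * f.T v * f.T u) := by
  rw [← map_neg]
  apply f.trace_eq_of_adjoint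
  intro a b
  simp only [Module.End.mul_apply, LinearMap.neg_apply, T_skew, map_neg, neg_neg]

omit [Module.Finite ℝ L] in
-- Invariance of `B` moves the structure constants of `[𝔨, 𝔭]` to those of `[𝔭, 𝔭]_𝔨`, which trades
-- a sum over the frame of `𝔨` for one over the frame of `𝔭`.
theorem sum_lie_c (φ : L →ₗ[ℝ] L →ₗ[ℝ] ℝ) {x : L} (hx : f.P x = x) :
    ∑ i, φ (f.c i) ⁅f.c i, x⁆ = - ∑ a, φ (f.K ⁅x, f.e a⁆) (f.e a) := by
  have h1 : ∀ i, φ (f.c i) ⁅f.c i, x⁆ =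
      ∑ a, killingForm ℝ L (f.c i) ⁅x, f.e a⁆ * φ (f.c i) (f.e a) := by
    intro i
    rw [← f.P_lie_k_p (f.K_c i) hx, P_apply, map_sum]
    exact Finset.sum_congr rfl fun a _ => by
      rw [map_smul, smul_eq_mul, killingForm_symm, killingForm_lie]
  simp only [h1, K_apply, map_neg, LinearMap.neg_apply, map_sum, LinearMap.sum_apply, map_smul,
    LinearMap.smul_apply, smul_eq_mul, Finset.sum_neg_distrib, neg_neg]
  exact Finset.sum_comm

/-- The component of `ad x * ad y` on `𝔭` which passes through `𝔨`. -/
def S (x y : L) : Module.End ℝ L := f.P * ad ℝ L x * f.K * ad ℝ L y * f.P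

omit [Module.Finite ℝ L] in
theorem S_adjoint (x y u v : L) :
    killingForm ℝ L (f.S x y u) v = killingForm ℝ L u (f.S y x v) := by
  simp only [S, Module.End.mul_apply, LieAlgebra.ad_apply, killingForm_P, killingForm_K,
    killingForm_lie', neg_neg]

omit [Module.Finite ℝ L] in
-- The `𝔭`-block of `ad [x, y] = [ad x, ad y]`, with `1 = P + K` inserted between the factors.
theorem commutator_T {x y : L} (hy : f.P y = y) :
    f.T x * f.T y - f.T y * f.T x - f.T (f.T x y) =
      f.S y x - f.S x y + f.T (f.K ⁅x, y⁆) := by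
  have h : f.T (f.T x y) + f.T (f.K ⁅x, y⁆) =
      f.P * (ad ℝ L x * (f.P + f.K) * ad ℝ L y - ad ℝ L y * (f.P + f.K) * ad ℝ L x) * f.P := by
    rw [← map_add, T_apply f x y, hy, P_apply_add_K_apply, P_add_K, mul_one, mul_one, T_eq,
      ad_lie]
  have h2 : ∀ u v, f.T u * f.T v = f.P * (ad ℝ L u * f.P * ad ℝ L v) * f.P := by
    intro u v
    rw [T_eq, T_eq, mul_assoc f.P (ad ℝ L v), ← mul_assoc (f.P * _ * f.P), mul_assoc _ f.P f.P,
      P_mul_P]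
    simp only [mul_assoc]
  rw [h2, h2]
  rw [← sub_eq_zero]
  have h3 : f.T (f.T x y) = f.P * (ad ℝ L x * (f.P + f.K) * ad ℝ L y
    - ad ℝ L y * (f.P + f.K) * ad ℝ L x) * f.P - f.T (f.K ⁅x, y⁆) := by rw [← h]; abel
  rw [h3, S, S]
  noncomm_ring

/-- Pairing the value at `u` with `e b` turns the sum into `tr (T (e b) * T (K u))`, which vanishes
by `trace_T_mul_T`. -/
theorem sum_T_mul_ad_mul_K : ∑ a, f.T (f.e a) * ad ℝ L (f.e a) * f.K = 0 := by
  ext u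
  rw [LinearMap.zero_apply, LinearMap.sum_apply]
  apply f.e_ext
  · rw [map_sum]; exact Finset.sum_congr rfl fun a _ => f.P_T_apply _ _
  intro b
  have h := f.trace_T_mul_T (f.K_K u) (f.P_e b)
  rw [← f.T_mul_P (f.e b), ← mul_assoc, trace_mul_P] at h
  rw [map_sum, ← h]
  refine Finset.sum_congr rfl fun a _ => ?_
  rw [Module.End.mul_apply, Module.End.mul_apply, Module.End.mul_apply, killingForm_symm,
    T_skew, T_skew, LieAlgebra.ad_apply, f.T_comm (f.P_e a) (f.P_e b), f.T_of_mem (f.K_K u),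
    Module.End.mul_apply, P_e, LieAlgebra.ad_apply, ← lie_skew (f.K u), map_neg, map_neg,
    killingForm_symm]

/-- Both sides are the same double sum over the frame of `𝔭`: skewness of `T` and `T x y = -T y x`
let the summation index and the trace index change places. -/
theorem sum_trace_T_mul_ad_mul_K {X X' Y : Module.End ℝ L} (Z : Module.End ℝ L)
    (hX : ∀ u v, killingForm ℝ L (X u) v = killingForm ℝ L u (X' v))
    (hY : ∀ a, f.P (Y (f.e a)) = Y (f.e a)) :
    ∑ a, trace ℝ L (f.T (Y (f.e a)) * X * ad ℝ L (f.e a) * f.K * Z * f.P) =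
      ∑ a, trace ℝ L (f.T (f.K (Z (f.e a))) * X' * f.T (f.e a) * Y * f.P) := by
  simp only [trace_mul_P]
  rw [Finset.sum_comm]
  refine Finset.sum_congr rfl fun b _ => Finset.sum_congr rfl fun a _ => ?_
  simp only [Module.End.mul_apply]
  rw [T_skew, hX, f.T_comm (hY a) (f.P_e b), LieAlgebra.ad_apply, ← lie_skew, map_neg,
    LinearMap.neg_apply, map_neg, map_neg, neg_neg]
  set k := f.K (Z (f.e b))
  have : ⁅k, f.e a⁆ = f.T k (f.e a) := by
    rw [f.T_of_mem (f.K_K _), Module.End.mul_apply, P_e, LieAlgebra.ad_apply]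
  rw [this, T_skew, neg_neg, killingForm_symm]

/-- The form `(u, w) ↦ tr (T u * T x * T w)`. -/
def traceTTT (x : L) : L →ₗ[ℝ] L →ₗ[ℝ] ℝ :=
  LinearMap.mk₂ ℝ (fun u w => trace ℝ L (f.T u * f.T x * f.T w))
    (by simp [add_mul]) (by simp) (by simp [mul_add]) (by simp)

omit [Module.Finite ℝ L] in
theorem traceTTT_apply (x u w : L) :
    f.traceTTT x u w = trace ℝ L (f.T u * f.T x * f.T w) := rfl

/-- Write one factor as `[T c, T x]`; the two resulting terms agree by reversal and cyclicity of the
trace. -/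
theorem trace_T_lie_mul_self {c x : L} (hc : f.K c = c) :
    trace ℝ L (f.T ⁅c, x⁆ * f.T ⁅c, x⁆) = 2 * trace ℝ L (f.T c * f.T x * f.T ⁅c, x⁆) := by
  have h1 : f.T ⁅c, x⁆ * f.T ⁅c, x⁆ =
      f.T c * f.T x * f.T ⁅c, x⁆ - f.T x * f.T c * f.T ⁅c, x⁆ := by
    rw [← sub_mul, ← f.T_lie hc]
  have h2 := LinearMap.trace_mul_cycle ℝ (f.T c) (f.T x) (f.T ⁅c, x⁆)
  rw [h1, map_sub, f.trace_T_mul_T_mul_T x c]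
  linarith

/-- The heart of the Cartan relation. Two families of skew operators on `𝔭` have sums of `tr F²`
equal to `6t` and `-2t`. Both are nonpositive, so `t = 0`. -/
theorem trace_T_mul_T_mul_T_eq {x : L} (hx : f.P x = x) :
    ∑ a, trace ℝ L (f.T (f.K ⁅x, f.e a⁆) * f.T x * f.T (f.e a)) = 0 := by
  set t := ∑ a, trace ℝ L (f.T (f.K ⁅x, f.e a⁆) * f.T x * f.T (f.e a)) with ht
  have hcyc : ∀ u v w, trace ℝ L (f.T u * f.T v * f.T w) = trace ℝ L (f.T w * f.T u * f.T v) :=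
    fun u v w => by rw [LinearMap.trace_mul_comm, ← mul_assoc]
  -- The defect of `T` from respecting brackets. It is skew on `𝔭`, and `commutator_T` expresses it
  -- through brackets that pass through `𝔨`.
  let q : L → Module.End ℝ L := fun y => f.T x * f.T y - f.T y * f.T x - f.T (f.T x y)
  have hqP : ∀ y, q y * f.P = q y := fun y => by
    simp only [q, sub_mul, mul_assoc, T_mul_P]
  have hPq : ∀ y, f.P * q y = q y := fun y => by
    simp only [q, mul_sub, ← mul_assoc, P_mul_T]
  have hq : ∀ y u v, killingForm ℝ L (q y u) v = - killingForm ℝ L u (q y v) := fun y u v => by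
    simp only [q, LinearMap.sub_apply, Module.End.mul_apply, map_sub, T_skew]; ring
  have hS : ∀ a, f.S (f.e a) x = f.P * ad ℝ L (f.e a) * f.K * ad ℝ L x * f.P := fun a => rfl
  have h0 : ∑ a, trace ℝ L (f.T x * f.T (f.e a) * f.S (f.e a) x) = 0 := by
    have : ∀ a, f.T x * f.T (f.e a) * f.S (f.e a) x =
        f.T x * (f.T (f.e a) * ad ℝ L (f.e a) * f.K) * (ad ℝ L x * f.P) := fun a => by
      rw [hS]; conv_rhs => rw [← f.T_mul_P (f.e a)]
      simp only [mul_assoc]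
    simp only [this]
    rw [← map_sum, ← Finset.sum_mul, ← Finset.mul_sum, sum_T_mul_ad_mul_K]
    simp
  have hb : ∑ a, trace ℝ L (f.T (f.e a) * f.T x * f.S (f.e a) x) = - t := by
    have := f.sum_trace_T_mul_ad_mul_K (X := f.T x) (X' := - f.T x) (Y := 1) (ad ℝ L x)
      (fun u v => by rw [T_skew, LinearMap.neg_apply, map_neg]) (fun a => f.P_e a)
    rw [ht, ← Finset.sum_neg_distrib]
    convert this using 2 with a _ a _
    · rw [hS, Module.End.one_apply]
      simp only [← mul_assoc]
      rw [mul_assoc _ (f.T x) f.P, T_mul_P]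
    · rw [mul_one, mul_neg, neg_mul, neg_mul, map_neg, mul_assoc _ _ f.P, T_mul_P,
        LieAlgebra.ad_apply]
  have hc : ∑ a, trace ℝ L (f.T (f.T x (f.e a)) * f.S (f.e a) x) = - t := by
    have := f.sum_trace_T_mul_ad_mul_K (X := 1) (X' := 1) (Y := f.T x) (ad ℝ L x)
      (fun u v => rfl) (fun a => f.P_T_apply _ _)
    rw [ht, ← Finset.sum_neg_distrib]
    convert this using 2 with a _ a _
    · rw [hS, mul_one]
      simp only [← mul_assoc]
      rw [T_mul_P]
    · rw [mul_one, mul_assoc _ _ f.P, T_mul_P, LieAlgebra.ad_apply, trace_T_mul_T_mul_T, hcyc,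
        trace_T_mul_T_mul_T, hcyc, neg_neg, trace_T_mul_T_mul_T, neg_neg]
  have hqS : ∑ a, trace ℝ L (q (f.e a) * f.S (f.e a) x) = 2 * t := by
    simp only [q, sub_mul, map_sub, Finset.sum_sub_distrib, h0, hb, hc]; ring
  -- Only the second factor is rewritten by `commutator_T`. The two `S` terms are equal by
  -- adjunction and give `4t`; the `T (K [x, e a])` term gives `2t`.
  have hqq : ∑ a, trace ℝ L (q (f.e a) * q (f.e a)) = 6 * t := by
    have h1 : ∀ a, trace ℝ L (q (f.e a) * q (f.e a)) =
        2 * trace ℝ L (q (f.e a) * f.S (f.e a) x)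
        + 2 * trace ℝ L (f.T (f.K ⁅x, f.e a⁆) * f.T x * f.T (f.e a)) := by
      intro a
      have h2 : trace ℝ L (q (f.e a) * f.S x (f.e a)) = - trace ℝ L (q (f.e a) * f.S (f.e a) x) := by
        rw [LinearMap.trace_mul_comm ℝ (q (f.e a)) (f.S (f.e a) x), ← map_neg]
        apply f.trace_eq_of_adjoint
        intro u v
        rw [Module.End.mul_apply, hq, S_adjoint, LinearMap.neg_apply, map_neg]
        rfl
      have h3 : trace ℝ L (q (f.e a) * f.T (f.K ⁅x, f.e a⁆)) =
          2 * trace ℝ L (f.T (f.K ⁅x, f.e a⁆) * f.T x * f.T (f.e a)) := by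
        have h4 := f.trace_T_mul_T (f.K_K ⁅x, f.e a⁆) (f.P_T_apply x (f.e a))
        rw [LinearMap.trace_mul_comm] at h4
        have h5 := f.trace_T_mul_T_mul_T (f.e a) x (f.K ⁅x, f.e a⁆)
        simp only [q, sub_mul, map_sub, h4, h5]
        rw [hcyc]; ring
      have h6 : q (f.e a) * q (f.e a) = q (f.e a) * f.S (f.e a) x - q (f.e a) * f.S x (f.e a)
          + q (f.e a) * f.T (f.K ⁅x, f.e a⁆) := by
        rw [← mul_sub, ← mul_add, ← f.commutator_T (f.P_e a)]
      rw [h6, map_add, map_sub, h2, h3]; ring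
    simp only [h1, Finset.sum_add_distrib, ← Finset.mul_sum, hqS, ← ht]; ring
  have hle : 6 * t ≤ 0 := by
    rw [← hqq]
    exact Finset.sum_nonpos fun a _ => f.trace_mul_self_nonpos (hqP _) (hPq _) (hq _)
  -- Here the skew operators are the `T [c i, x]`, and `sum_lie_c` converts the sum of their `tr F²`
  -- into `-2t`.
  have hge : 0 ≤ 2 * t := by
    have h1 := f.sum_lie_c (f.traceTTT x) hx
    simp only [traceTTT_apply] at h1
    have h2 : ∀ i, trace ℝ L (f.T ⁅f.c i, x⁆ * f.T ⁅f.c i, x⁆) =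
        2 * trace ℝ L (f.T (f.c i) * f.T x * f.T ⁅f.c i, x⁆) := fun i => by
      rw [f.trace_T_lie_mul_self (f.K_c i)]
    have h3 : ∑ i, trace ℝ L (f.T ⁅f.c i, x⁆ * f.T ⁅f.c i, x⁆) ≤ 0 :=
      Finset.sum_nonpos fun i _ => f.trace_mul_self_nonpos (f.T_mul_P _) (f.P_mul_T _) (f.T_skew _)
    simp only [h2, ← Finset.mul_sum, h1, ← ht] at h3
    linarith
  linarith

theorem T_lie_c_eq_zero {x : L} (hx : f.P x = x) (i : κ) : f.T ⁅f.c i, x⁆ = 0 := by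
  have h0 : ∑ i, trace ℝ L (f.T ⁅f.c i, x⁆ * f.T ⁅f.c i, x⁆) = 0 := by
    have h1 := f.sum_lie_c (f.traceTTT x) hx
    simp only [traceTTT_apply, f.trace_T_mul_T_mul_T_eq hx] at h1
    simp only [f.trace_T_lie_mul_self (f.K_c _), ← Finset.mul_sum, h1]
    simp
  rw [Finset.sum_eq_zero_iff_of_nonpos fun i _ =>
    f.trace_mul_self_nonpos (f.T_mul_P _) (f.P_mul_T _) (f.T_skew _)] at h0
  exact f.eq_zero_of_trace_mul_self_nonneg (f.T_mul_P _) (f.P_mul_T _) (f.T_skew _)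
    (h0 i (by simp)).ge

/-- If `x` commutes with `𝔨`, then `ad x` kills `𝔨` and preserves `𝔭`. So `B(x, x) = tr (T x)² ≤ 0`,
against positivity of `B` on `𝔭`. -/
theorem eq_zero_of_lie_c_eq_zero {x : L} (hx : f.P x = x) (h : ∀ i, ⁅f.c i, x⁆ = 0) : x = 0 := by
  apply f.eq_zero_of_killingForm_self_nonpos hx
  have hK : ad ℝ L x * f.K = 0 := by
    ext u
    rw [Module.End.mul_apply, K_apply, LieAlgebra.ad_apply, lie_neg, lie_sum,
      LinearMap.zero_apply, neg_eq_zero]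
    exact Finset.sum_eq_zero fun i _ => by rw [lie_smul, ← lie_skew, h, neg_zero, smul_zero]
  have hK' : f.K * ad ℝ L x * f.P = 0 := by
    ext u
    rw [Module.End.mul_apply, Module.End.mul_apply, K_apply, LinearMap.zero_apply, neg_eq_zero]
    refine Finset.sum_eq_zero fun i _ => ?_
    rw [LieAlgebra.ad_apply, ← killingForm_lie, h, map_zero, LinearMap.zero_apply, zero_smul]
  have hT : ad ℝ L x * f.P = f.T x := by
    rw [T_eq]
    conv_lhs => rw [← one_mul (ad ℝ L x), ← f.P_add_K, add_mul, add_mul, hK', add_zero]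
  rw [killingForm_apply_apply, ← Module.End.mul_eq_comp, f.trace_eq, mul_assoc _ _ f.K, hK,
    mul_zero, map_zero, add_zero, mul_assoc, hT, ← f.P_mul_T, ← mul_assoc, hT]
  exact f.trace_mul_self_nonpos (f.T_mul_P _) (f.P_mul_T _) (f.T_skew _)

/-- The space `𝔭` satisfies `[𝔭, 𝔭] ⊆ 𝔨`: the decomposition is a Cartan decomposition. -/
theorem P_lie_p_p {x y : L} (hx : f.P x = x) (hy : f.P y = y) : f.P ⁅x, y⁆ = 0 := by
  -- The operators `T z` vanish for `z ∈ [𝔨, 𝔭]`. By invariance of `B` this makes `T x y` commute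
  -- with `𝔨`, so it is zero.
  have h : f.T x y = 0 := by
    apply f.eq_zero_of_lie_c_eq_zero (f.P_T_apply x y)
    intro i
    apply f.e_ext (f.P_lie_k_p (f.K_c i) (f.P_T_apply x y))
    intro a
    rw [killingForm_symm, killingForm_lie', T_skew, neg_neg,
      f.T_comm hx (f.P_lie_k_p (f.K_c i) (f.P_e a)), f.T_lie_c_eq_zero (f.P_e a)]
    simp
  rwa [T_apply, hy] at h

end trace
end KillingFrame

/-! ### The Levi-Civita product of a diagonal form and the traces of its curvature -/

namespace KillingFrame

variable {L : Type*} [LieRing L] [LieAlgebra ℝ L] {n κ : Type*} [Fintype n] [Fintype κ]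
  (f : KillingFrame L n κ)

/-- A symmetric `𝔨`-equivariant endomorphism of `𝔨`, extended by zero to `𝔭`. -/
structure IsEquivariant (M : Module.End ℝ L) : Prop where
  K_mul : f.K * M = M
  mul_K : M * f.K = M
  symm : ∀ u v, killingForm ℝ L (M u) v = killingForm ℝ L u (M v)
  comm : ∀ k, f.K k = k → M * ad ℝ L k = ad ℝ L k * M

theorem isEquivariant_K : f.IsEquivariant f.K :=
  ⟨f.K_mul_K, f.K_mul_K, f.killingForm_K, fun _ hk => f.K_mul_ad hk⟩

variable {f} {M : Module.End ℝ L}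

namespace IsEquivariant

theorem K_apply (hM : f.IsEquivariant M) (u : L) : f.K (M u) = M u := LinearMap.congr_fun hM.K_mul u

theorem apply_p (hM : f.IsEquivariant M) {x : L} (hx : f.P x = x) : M x = 0 := by
  rw [← hM.mul_K, Module.End.mul_apply, f.K_eq_zero hx, map_zero]

theorem lie (hM : f.IsEquivariant M) {k : L} (hk : f.K k = k) (u : L) : M ⁅k, u⁆ = ⁅k, M u⁆ :=
  LinearMap.congr_fun (hM.comm k hk) u

variable [Module.Finite ℝ L]

theorem trace_mul_ad_mul_ad (hM : f.IsEquivariant M) (x y : L) :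
    trace ℝ L (M * ad ℝ L x * ad ℝ L y) = trace ℝ L (M * ad ℝ L y * ad ℝ L x) := by
  rw [mul_assoc M, LinearMap.trace_mul_comm]
  apply f.trace_eq_of_adjoint
  intro u v
  simp only [Module.End.mul_apply, LieAlgebra.ad_apply, killingForm_lie', hM.symm, neg_neg]

omit [Module.Finite ℝ L] in
-- The factor `P` is redundant: `ad y` maps `𝔨` into `𝔭`, where `M` vanishes. The rest is cyclicity.
theorem trace_ad_mul_mul_ad_mul_P (hM : f.IsEquivariant M) (x : L) {y : L} (hy : f.P y = y) :
    trace ℝ L (ad ℝ L x * M * ad ℝ L y * f.P) = trace ℝ L (M * ad ℝ L y * ad ℝ L x) := by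
  have h : M * ad ℝ L y * f.P = M * ad ℝ L y := by
    conv_rhs => rw [← mul_one (M * ad ℝ L y), ← f.P_add_K, mul_add]
    rw [← hM.mul_K]
    simp only [mul_assoc]
    rw [← mul_assoc f.K (ad ℝ L y) f.K, f.K_ad_K hy, mul_zero, add_zero]
  rw [mul_assoc, mul_assoc, ← mul_assoc M, h, LinearMap.trace_mul_comm]

end IsEquivariant

variable (f M) [Module.Finite ℝ L]

/-- The Levi-Civita connection on left-invariant fields. -/
def U : L →ₗ[ℝ] L →ₗ[ℝ] L :=
  -- The coefficients are the solution of the Koszul formula, block by block, for the form `B(P·,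
  -- P·) - 2 B(M·, ·)`.
  LinearMap.mk₂ ℝ (fun X Y => (1 / 2 : ℝ) • ⁅f.P X, f.P Y⁆ - ⁅f.P X, M Y⁆ + ⁅f.K X + M X, f.P Y⁆
      + (1 / 2 : ℝ) • ⁅f.K X, f.K Y⁆)
    (fun _ _ _ => by simp only [map_add, add_lie, smul_add]; abel)
    (fun _ _ _ => by simp only [map_smul, smul_lie, add_lie]; module)
    (fun _ _ _ => by simp only [map_add, lie_add, add_lie, smul_add]; abel)
    (fun _ _ _ => by simp only [map_smul, lie_smul, add_lie]; module)

omit [Module.Finite ℝ L] in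
theorem U_apply (X Y : L) : f.U M X Y =
    (1 / 2 : ℝ) • ⁅f.P X, f.P Y⁆ - ⁅f.P X, M Y⁆ + ⁅f.K X + M X, f.P Y⁆
      + (1 / 2 : ℝ) • ⁅f.K X, f.K Y⁆ := rfl

theorem P_lie_P_P (u v : L) : f.P ⁅f.P u, f.P v⁆ = 0 := f.P_lie_p_p (f.P_P u) (f.P_P v)

theorem K_lie_p_p {x y : L} (hx : f.P x = x) (hy : f.P y = y) : f.K ⁅x, y⁆ = ⁅x, y⁆ :=
  f.K_eq_self (by rw [← hx, ← hy, P_lie_P_P])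

theorem U_sub_U (X Y : L) : f.U M X Y - f.U M Y X = ⁅X, Y⁆ := by
  have h : ⁅X, Y⁆ = ⁅f.P X + f.K X, f.P Y + f.K Y⁆ := by
    rw [P_apply_add_K_apply, P_apply_add_K_apply]
  rw [U_apply, U_apply, h]
  simp only [add_lie, lie_add]
  rw [← lie_skew (f.P Y) (f.P X), ← lie_skew (f.P Y) (M X), ← lie_skew (f.K Y) (f.P X),
    ← lie_skew (f.K Y) (f.K X), ← lie_skew (M Y) (f.P X)]
  module

variable {f M} (hM : f.IsEquivariant M)
include hM

omit [Module.Finite ℝ L] in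
theorem U_pp {x y : L} (hx : f.P x = x) (hy : f.P y = y) :
    f.U M x y = (1 / 2 : ℝ) • ⁅x, y⁆ := by
  simp [U_apply, hx, hy, f.K_eq_zero hx, f.K_eq_zero hy, hM.apply_p hx, hM.apply_p hy]

omit [Module.Finite ℝ L] in
theorem U_pk {x k : L} (hx : f.P x = x) (hk : f.K k = k) : f.U M x k = - ⁅x, M k⁆ := by
  simp [U_apply, hx, f.K_eq_zero hx, f.P_eq_zero hk, hM.apply_p hx]

omit [Module.Finite ℝ L] in
theorem U_kp {k x : L} (hk : f.K k = k) (hx : f.P x = x) : f.U M k x = ⁅k + M k, x⁆ := by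
  simp [U_apply, hx, hk, f.K_eq_zero hx, f.P_eq_zero hk]

omit [Module.Finite ℝ L] in
theorem U_kk {k l : L} (hk : f.K k = k) (hl : f.K l = l) :
    f.U M k l = (1 / 2 : ℝ) • ⁅k, l⁆ := by
  simp [U_apply, hk, hl, f.P_eq_zero hk, f.P_eq_zero hl]

omit [Module.Finite ℝ L] in
theorem K_add_M {k : L} (hk : f.K k = k) : f.K (k + M k) = k + M k := by
  rw [map_add, hk, hM.K_apply]

/-- Metric compatibility of `U` for the form `B(P·, P·) - 2 B(M·, ·)`, which is `g / β` once `M` is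
`αᵢ / (2β)` on `𝔨ᵢ`. -/
theorem U_skew (X Y Z : L) :
    killingForm ℝ L (f.P (f.U M X Y)) (f.P Z) - 2 * killingForm ℝ L (M (f.U M X Y)) Z =
      -(killingForm ℝ L (f.P Y) (f.P (f.U M X Z)) - 2 * killingForm ℝ L (M Y) (f.U M X Z)) := by
  have hMP : ∀ u, M (f.P u) = 0 := fun u => hM.apply_p (f.P_P u)
  have hMK : ∀ u, M (f.K u) = M u := fun u => LinearMap.congr_fun hM.mul_K u
  have hP : ∀ Y, f.P (f.U M X Y) = - ⁅f.P X, M Y⁆ + ⁅f.K X + M X, f.P Y⁆ := by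
    intro Y
    have hKM : f.K (f.K X + M X) = f.K X + M X := by rw [map_add, f.K_K, hM.K_apply]
    rw [U_apply, map_add, map_add, map_sub, map_smul, map_smul, P_lie_P_P,
      f.P_lie_p_k (f.P_P X) (hM.K_apply Y), f.P_lie_k_p hKM (f.P_P Y), P_lie_K_K]
    simp
  have hM' : ∀ Y, M (f.U M X Y) = (1 / 2 : ℝ) • M ⁅f.P X, f.P Y⁆ + (1 / 2 : ℝ) • ⁅f.K X, M Y⁆ := by
    intro Y
    have hKM : f.K (f.K X + M X) = f.K X + M X := by rw [map_add, f.K_K, hM.K_apply]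
    rw [U_apply, map_add, map_add, map_sub, map_smul, map_smul,
      hM.apply_p (f.P_lie_p_k (f.P_P X) (hM.K_apply Y)),
      hM.apply_p (f.P_lie_k_p hKM (f.P_P Y)), hM.lie (f.K_K X), hMK]
    simp
  have hZ : ∀ v, killingForm ℝ L v (f.P Z) = killingForm ℝ L (f.P v) Z :=
    fun v => (f.killingForm_P v Z).symm
  rw [hM.symm Y, hP, hM', hP, hM']
  simp only [map_add, map_neg, map_smul, LinearMap.add_apply, LinearMap.neg_apply,
    LinearMap.smul_apply, smul_eq_mul, hM.symm, add_lie]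
  have e1 : killingForm ℝ L ⁅f.P X, M Y⁆ (f.P Z) = - killingForm ℝ L Y (M ⁅f.P X, f.P Z⁆) := by
    rw [killingForm_lie', hM.symm]
  have e2 : killingForm ℝ L ⁅f.P X, f.P Y⁆ (M Z) = - killingForm ℝ L (f.P Y) ⁅f.P X, M Z⁆ := by
    rw [killingForm_lie']
  have e3 : killingForm ℝ L ⁅f.K X, M Y⁆ Z = - killingForm ℝ L Y ⁅f.K X, M Z⁆ := by
    rw [killingForm_lie', hM.symm, hM.lie (f.K_K X)]
  rw [e1, e2, e3, killingForm_lie' (f.K X), killingForm_lie' (M X)]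
  ring

variable (f M) in
omit hM in
/-- The linear map `Z ↦ R(Z, X)Y` on left-invariant fields. -/
def riem (X Y : L) : Module.End ℝ L :=
  (f.U M).flip (f.U M X Y) - f.U M X ∘ₗ (f.U M).flip Y + (f.U M).flip Y ∘ₗ ad ℝ L X

omit hM in
omit [Module.Finite ℝ L] in
theorem riem_apply (X Y Z : L) :
    f.riem M X Y Z = f.U M Z (f.U M X Y) - f.U M X (f.U M Z Y) - f.U M ⁅Z, X⁆ Y := by
  rw [riem, ← lie_skew Z X, map_neg, LinearMap.neg_apply, sub_neg_eq_add]
  rfl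

omit hM in
theorem trace_eq_zero {F : Module.End ℝ L} (hp : ∀ a, f.P (F (f.e a)) = 0)
    (hk : ∀ i, f.K (F (f.c i)) = 0) : trace ℝ L F = 0 := by
  rw [f.trace_eq, trace_mul_P, trace_mul_K, Finset.sum_eq_zero, Finset.sum_eq_zero]
  · simp
  · intro i _
    rw [← f.K_c i, ← f.killingForm_K, f.K_c, hk]; simp
  · intro i _
    rw [← f.P_e i, ← f.killingForm_P, f.P_e, hp]; simp

omit hM in
theorem trace_ad_mul_P {k : L} (hk : f.K k = k) : trace ℝ L (ad ℝ L k * f.P) = 0 := by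
  have : trace ℝ L (ad ℝ L k * f.P) = - trace ℝ L (ad ℝ L k * f.P) := by
    rw [← map_neg]
    apply f.trace_eq_of_adjoint
    intro u v
    rw [← f.P_mul_ad hk, Module.End.mul_apply, f.killingForm_P, LieAlgebra.ad_apply,
      killingForm_lie', LinearMap.neg_apply, map_neg, f.P_mul_ad hk]; rfl
  linarith

omit hM in
theorem trace_ad_mul_K {k : L} (hk : f.K k = k) : trace ℝ L (ad ℝ L k * f.K) = 0 := by
  have : trace ℝ L (ad ℝ L k * f.K) = - trace ℝ L (ad ℝ L k * f.K) := by
    rw [← map_neg]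
    apply f.trace_eq_of_adjoint
    intro u v
    rw [← f.K_mul_ad hk, Module.End.mul_apply, f.killingForm_K, LieAlgebra.ad_apply,
      killingForm_lie', LinearMap.neg_apply, map_neg, f.K_mul_ad hk]; rfl
  linarith

omit hM in
theorem trace_ad_mul_ad_mul_P {k l : L} (hk : f.K k = k) (hl : f.K l = l) :
    trace ℝ L (ad ℝ L k * ad ℝ L l * f.P) = trace ℝ L (ad ℝ L l * ad ℝ L k * f.P) := by
  apply f.trace_eq_of_adjoint
  intro u v
  rw [mul_assoc, ← f.P_mul_ad hl, ← mul_assoc, ← f.P_mul_ad hk]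
  simp only [Module.End.mul_apply, LieAlgebra.ad_apply, killingForm_lie', killingForm_P, neg_neg]

omit hM in
theorem trace_ad_mul_ad_mul_K {k l : L} (hk : f.K k = k) (hl : f.K l = l) :
    trace ℝ L (ad ℝ L k * ad ℝ L l * f.K) = trace ℝ L (ad ℝ L l * ad ℝ L k * f.K) := by
  apply f.trace_eq_of_adjoint
  intro u v
  rw [mul_assoc, ← f.K_mul_ad hl, ← mul_assoc, ← f.K_mul_ad hk]
  simp only [Module.End.mul_apply, LieAlgebra.ad_apply, killingForm_lie', killingForm_K, neg_neg]

omit hM in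
-- Meant for the curvature operator, which has one closed formula on `𝔭` and another on `𝔨`.
theorem trace_eq_of_apply {R F H : Module.End ℝ L} (hF : ∀ a, R (f.e a) = F (f.e a))
    (hH : ∀ i, R (f.c i) = H (f.c i)) :
    trace ℝ L R = trace ℝ L (F * f.P) + trace ℝ L (H * f.K) := by
  rw [f.trace_eq]
  simp only [trace_mul_P, trace_mul_K, hF, hH]

theorem trace_riem_pp {x y : L} (hx : f.P x = x) (hy : f.P y = y) :
    trace ℝ L (f.riem M x y) = - trace ℝ L ((f.K + M) * ad ℝ L y * ad ℝ L x) := by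
  have hxy := f.K_lie_p_p hx hy
  rw [trace_eq_of_apply (f := f)
    -- `F` and `H` are `Z ↦ R(Z, x)y` for `Z` in `𝔭` and in `𝔨`. With `m = tr (M ad y ad x)` and `k
    -- = tr (K ad y ad x)` their contributions are `-(3/2) m - k` and `m / 2`.
    (F := (1 / 2 : ℝ) • ad ℝ L (M ⁅x, y⁆) - (1 / 2 : ℝ) • (ad ℝ L x * M * ad ℝ L y)
      - ad ℝ L y * f.K * ad ℝ L x - ad ℝ L y * M * ad ℝ L x)
    (H := -(1 / 4 : ℝ) • ad ℝ L ⁅x, y⁆ + (1 / 2 : ℝ) • (ad ℝ L x * ad ℝ L y)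
      + (1 / 2 : ℝ) • (ad ℝ L x * ad ℝ L y * M) - (1 / 2 : ℝ) • (ad ℝ L y * ad ℝ L x))]
  · have h1 := trace_ad_mul_P (hM.K_apply ⁅x, y⁆)
    have h2 := trace_ad_mul_K hxy
    have h3 := hM.trace_ad_mul_mul_ad_mul_P x hy
    have h4 := hM.trace_ad_mul_mul_ad_mul_P y hx
    have h5 := f.isEquivariant_K.trace_ad_mul_mul_ad_mul_P y hx
    have h6 := hM.trace_mul_ad_mul_ad x y
    have h7 := f.isEquivariant_K.trace_mul_ad_mul_ad x y
    have h8 : trace ℝ L (ad ℝ L x * ad ℝ L y * f.K) = trace ℝ L (f.K * ad ℝ L x * ad ℝ L y) := by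
      rw [LinearMap.trace_mul_comm, mul_assoc]
    have h9 : trace ℝ L (ad ℝ L y * ad ℝ L x * f.K) = trace ℝ L (f.K * ad ℝ L y * ad ℝ L x) := by
      rw [LinearMap.trace_mul_comm, mul_assoc]
    have h10 : trace ℝ L (ad ℝ L x * ad ℝ L y * M) = trace ℝ L (M * ad ℝ L x * ad ℝ L y) := by
      rw [LinearMap.trace_mul_comm, mul_assoc]
    simp only [sub_mul, add_mul, smul_mul_assoc, map_sub, map_add, map_smul, smul_eq_mul, h1, h2,
      h3, h4, h5, h8, h9, mul_assoc _ M f.K, hM.mul_K, h10, h6, h7]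
    ring
  · intro a
    have he := f.P_e a
    rw [riem_apply, U_pp hM hx hy, U_pp hM he hy, map_smul, map_smul, U_pk hM he hxy,
      U_pk hM hx (f.K_lie_p_p he hy), U_kp hM (f.K_lie_p_p he hx) hy]
    simp only [LinearMap.sub_apply, LinearMap.smul_apply, Module.End.mul_apply,
      LieAlgebra.ad_apply, f.K_lie_p_p hx he]
    rw [← lie_skew y (f.e a), ← lie_skew (M ⁅x, y⁆), ← lie_skew x (f.e a), map_neg, map_neg,
      lie_neg, lie_neg, lie_neg, add_lie, ← lie_skew y, ← lie_skew y]
    module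
  · intro i
    have hc := f.K_c i
    rw [riem_apply, U_pp hM hx hy, U_kp hM hc hy, map_smul, U_kk hM hc hxy,
      U_pp hM hx (f.P_lie_k_p (K_add_M hM hc) hy), U_pp hM (f.P_lie_k_p hc hx) hy]
    simp only [LinearMap.sub_apply, LinearMap.add_apply, LinearMap.smul_apply,
      Module.End.mul_apply, LieAlgebra.ad_apply]
    rw [add_lie, lie_add, ← lie_skew y (f.c i), ← lie_skew y (M (f.c i)), ← lie_skew x (f.c i),
      ← lie_skew (f.c i) ⁅x, y⁆, lie_neg, lie_neg, lie_neg, ← lie_skew y]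
    module

theorem trace_riem_kk {k l : L} (hk : f.K k = k) (hl : f.K l = l) :
    trace ℝ L (f.riem M k l) = - trace ℝ L (ad ℝ L (M k) * ad ℝ L (M l) * f.P)
      - 1 / 4 * trace ℝ L (ad ℝ L k * ad ℝ L l * f.K) := by
  have hkl := f.K_lie_k_k hk hl
  rw [trace_eq_of_apply (f := f)
    (F := (1 / 2 : ℝ) • ad ℝ L (M ⁅k, l⁆) - ad ℝ L k * ad ℝ L (M l) - ad ℝ L (M k) * ad ℝ L (M l)
      + ad ℝ L (M l) * ad ℝ L k)
    (H := -(1 / 4 : ℝ) • ad ℝ L ⁅k, l⁆ + (1 / 4 : ℝ) • (ad ℝ L k * ad ℝ L l)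
      - (1 / 2 : ℝ) • (ad ℝ L l * ad ℝ L k))]
  · simp only [sub_mul, add_mul, smul_mul_assoc, map_sub, map_add, map_smul, smul_eq_mul,
      trace_ad_mul_P (hM.K_apply ⁅k, l⁆), trace_ad_mul_K hkl,
      trace_ad_mul_ad_mul_P hk (hM.K_apply l), trace_ad_mul_ad_mul_K hk hl]
    ring
  · intro a
    have he := f.P_e a
    rw [riem_apply, U_kk hM hk hl, U_pk hM he hl, map_smul, map_neg, U_pk hM he hkl,
      U_kp hM hk (f.P_lie_p_k he (hM.K_apply l)), U_pk hM (f.P_lie_p_k he hk) hl]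
    simp only [LinearMap.sub_apply, LinearMap.add_apply, LinearMap.smul_apply,
      Module.End.mul_apply, LieAlgebra.ad_apply]
    rw [add_lie, ← lie_skew (f.e a) (M l), ← lie_skew (f.e a) k, ← lie_skew (f.e a) (M ⁅k, l⁆),
      lie_neg, lie_neg, neg_lie, ← lie_skew ⁅k, f.e a⁆]
    module
  · intro i
    have hc := f.K_c i
    rw [riem_apply, U_kk hM hk hl, U_kk hM hc hl, map_smul, map_smul, U_kk hM hc hkl,
      U_kk hM hk (f.K_lie_k_k hc hl), U_kk hM (f.K_lie_k_k hc hk) hl]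
    simp only [LinearMap.sub_apply, LinearMap.add_apply, LinearMap.smul_apply,
      Module.End.mul_apply, LieAlgebra.ad_apply]
    rw [← lie_skew (f.c i) l, ← lie_skew (f.c i) k, ← lie_skew (f.c i) ⁅k, l⁆,
      lie_neg, neg_lie, ← lie_skew ⁅k, f.c i⁆]
    module

theorem P_U_pp {x y : L} (hx : f.P x = x) (hy : f.P y = y) : f.P (f.U M x y) = 0 := by
  rw [U_pp hM hx hy, map_smul, f.P_eq_zero (f.K_lie_p_p hx hy), smul_zero]

theorem P_U_kk {x y : L} (hx : f.K x = x) (hy : f.K y = y) : f.P (f.U M x y) = 0 := by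
  rw [U_kk hM hx hy, map_smul, f.P_lie_k_k hx hy, smul_zero]

theorem K_U_pk {x y : L} (hx : f.P x = x) (hy : f.K y = y) : f.K (f.U M x y) = 0 := by
  rw [U_pk hM hx hy, map_neg, f.K_lie_p_k hx (hM.K_apply y), neg_zero]

theorem K_U_kp {x y : L} (hx : f.K x = x) (hy : f.P y = y) : f.K (f.U M x y) = 0 := by
  rw [U_kp hM hx hy, f.K_lie_k_p (K_add_M hM hx) hy]

/-- `U` respects the grading with `𝔨` even and `𝔭` odd, so `Z ↦ R(Z, x)k` exchanges `𝔭` and `𝔨` and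
has no diagonal part. -/
theorem trace_riem_pk {x k : L} (hx : f.P x = x) (hk : f.K k = k) :
    trace ℝ L (f.riem M x k) = 0 := by
  apply trace_eq_zero (f := f)
  · intro a
    have he := f.P_e a
    rw [riem_apply, map_sub, map_sub, P_U_pp hM he (f.P_eq_self (K_U_pk hM hx hk)),
      P_U_pp hM hx (f.P_eq_self (K_U_pk hM he hk)), P_U_kk hM (f.K_lie_p_p he hx) hk]
    simp
  · intro i
    have hc := f.K_c i
    rw [riem_apply, map_sub, map_sub, K_U_kp hM hc (f.P_eq_self (K_U_pk hM hx hk)),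
      K_U_pk hM hx (f.K_eq_self (P_U_kk hM hc hk)), K_U_pk hM (f.P_lie_k_p hc hx) hk]
    simp

theorem trace_riem_kp {x k : L} (hx : f.P x = x) (hk : f.K k = k) :
    trace ℝ L (f.riem M k x) = 0 := by
  apply trace_eq_zero (f := f)
  · intro a
    have he := f.P_e a
    rw [riem_apply, map_sub, map_sub, P_U_pp hM he (f.P_eq_self (K_U_kp hM hk hx)),
      P_U_kk hM hk (f.K_eq_self (P_U_pp hM he hx)), P_U_pp hM (f.P_lie_p_k he hk) hx]
    simp
  · intro i
    have hc := f.K_c i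
    rw [riem_apply, map_sub, map_sub, K_U_kp hM hc (f.P_eq_self (K_U_kp hM hk hx)),
      K_U_kp hM hk (f.P_eq_self (K_U_kp hM hc hx)), K_U_kp hM (f.K_lie_k_k hc hk) hx]
    simp

end KillingFrame

/-! ### Positive definite forms: orthonormal bases, eigenvectors, traces of skew maps -/

section Forms
variable {V : Type*} [AddCommGroup V] [Module ℝ V] [Module.Finite ℝ V]
  (h : LinearMap.BilinForm ℝ V) (hs : ∀ x y, h x y = h y x) (hp : ∀ x, x ≠ 0 → 0 < h x x)
include hs hp

omit [Module.Finite ℝ V] in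
theorem nonneg_of_pos (x : V) : 0 ≤ h x x := by
  by_cases hx : x = 0
  · simp [hx]
  · exact (hp x hx).le

/-- The inner product given by a positive definite symmetric bilinear form. -/
abbrev innerCore : InnerProductSpace.Core ℝ V where
  inner x y := h x y
  conj_inner_symm x y := hs y x
  re_inner_nonneg x := nonneg_of_pos h hs hp x
  add_left := by simp
  smul_left := by simp
  definite x hx := by
    by_contra h0
    exact (hp x h0).ne' hx

theorem exists_orthonormal_basis :
    ∃ b : Module.Basis (Fin (Module.finrank ℝ V)) ℝ V,
      ∀ i j, h (b i) (b j) = if i = j then 1 else 0 := by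
  let := (innerCore h hs hp).toNormedAddCommGroup
  let := InnerProductSpace.ofCore (innerCore h hs hp).toCore
  refine ⟨(stdOrthonormalBasis ℝ V).toBasis, fun i j => ?_⟩
  have := (orthonormal_iff_ite.1 (stdOrthonormalBasis ℝ V).orthonormal) i j
  rwa [← OrthonormalBasis.coe_toBasis] at this

/-- The spectral theorem in the shape needed for Schur-type arguments: the eigenspace of an
invariant `F` relative to an invariant `h` is an invariant subspace, and it is nonzero. -/
theorem exists_eigenvector [Nontrivial V] (F : LinearMap.BilinForm ℝ V)
    (hF : ∀ x y, F x y = F y x) : ∃ (μ : ℝ) (v : V), v ≠ 0 ∧ ∀ w, F v w = μ * h v w := by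
  obtain ⟨b, hb⟩ := exists_orthonormal_basis h hs hp
  let := (innerCore h hs hp).toNormedAddCommGroup
  let := InnerProductSpace.ofCore (innerCore h hs hp).toCore
  let T : V →ₗ[ℝ] V := ∑ i, (F (b i)).smulRight (b i)
  have hT : ∀ v w, h (T v) w = F v w := by
    intro v w
    have h1 : ∀ v i, h (T v) (b i) = F v (b i) := by
      intro v i
      simp [T, LinearMap.sum_apply, hb, hF v]
    have : h (T v) = F v := b.ext (h1 v)
    rw [this]
  have hsymm : T.IsSymmetric := fun x y => by
    change h (T x) y = h x (T y)
    rw [hT, hs, hT, hF]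
  obtain ⟨v, hv⟩ := hsymm.hasEigenvalue_iSup_of_finiteDimensional.exists_hasEigenvector
  exact ⟨_, v, hv.2, fun w => by rw [← hT, hv.apply_eq_smul, map_smul]; rfl⟩

omit [Module.Finite ℝ V] in
theorem trace_eq_sum_of_orthonormal {ι : Type*} [Fintype ι] [DecidableEq ι] (b : Module.Basis ι ℝ V)
    (hb : ∀ i j, h (b i) (b j) = if i = j then 1 else 0) (F : Module.End ℝ V) :
    trace ℝ V F = ∑ i, h (F (b i)) (b i) := by
  rw [LinearMap.trace_eq_matrix_trace ℝ b, Matrix.trace]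
  refine Finset.sum_congr rfl fun i _ => ?_
  rw [Matrix.diag_apply, LinearMap.toMatrix_apply]
  conv_rhs => rw [← b.sum_repr (F (b i))]
  simp only [map_sum, LinearMap.sum_apply, map_smul, LinearMap.smul_apply, hb]
  simp

theorem trace_mul_self_nonpos_of_skew (F : Module.End ℝ V)
    (hF : ∀ x y, h (F x) y = - h x (F y)) : trace ℝ V (F * F) ≤ 0 := by
  obtain ⟨b, hb⟩ := exists_orthonormal_basis h hs hp
  rw [trace_eq_sum_of_orthonormal h hs hp b hb]
  refine Finset.sum_nonpos fun i _ => ?_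
  rw [Module.End.mul_apply, hF, neg_nonpos]
  exact nonneg_of_pos h hs hp _

theorem trace_mul_self_neg_of_skew (F : Module.End ℝ V)
    (hF : ∀ x y, h (F x) y = - h x (F y)) (h0 : F ≠ 0) : trace ℝ V (F * F) < 0 := by
  obtain ⟨b, hb⟩ := exists_orthonormal_basis h hs hp
  rw [trace_eq_sum_of_orthonormal h hs hp b hb]
  obtain ⟨i, hi⟩ : ∃ i, F (b i) ≠ 0 := by
    by_contra! hc
    exact h0 (b.ext (by simpa using hc))
  refine Finset.sum_neg' (fun i _ => ?_) ⟨i, by simp, ?_⟩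
  · rw [Module.End.mul_apply, hF, neg_nonpos]
    exact nonneg_of_pos h hs hp _
  · rw [Module.End.mul_apply, hF, neg_lt_zero]
    exact hp _ hi

omit hp in
theorem isCompl_orthogonal_of_ne_zero (W : Submodule ℝ V) (hW : ∀ w ∈ W, w ≠ 0 → h w w ≠ 0) :
    IsCompl W (h.orthogonal W) := by
  rw [LinearMap.BilinForm.isCompl_orthogonal_iff_disjoint (fun x y hxy => by rw [hs, hxy]),
    Submodule.disjoint_def]
  intro x hx hx'
  by_contra h0
  exact hW x hx h0 (hx' x hx)

omit h hs hp in
theorem trace_eq_add_of_isCompl {p q : Submodule ℝ V} (hpq : IsCompl p q) (F : Module.End ℝ V)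
    (hFp : ∀ x ∈ p, F x ∈ p) (hFq : ∀ x ∈ q, F x ∈ q) :
    trace ℝ V F = trace ℝ p (F.restrict hFp) + trace ℝ q (F.restrict hFq) := by
  classical
  let N : Bool → Submodule ℝ V := fun b => cond b p q
  have hN : DirectSum.IsInternal N :=
    (DirectSum.isInternal_submodule_iff_isCompl N (i := true) (j := false) (by simp)
      (by ext b; cases b <;> simp)).2 hpq
  have hf : ∀ i, Set.MapsTo F (N i) (N i) := by
    intro i; cases i
    · exact hFq
    · exact hFp
  rw [LinearMap.trace_eq_sum_trace_restrict hN hf]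
  simp only [Fintype.sum_bool]
  rfl

end Forms

/-! ### Lie algebras with an invariant definite form -/

section Compact

variable {A : Type*} [LieRing A] [LieAlgebra ℝ A]

/-- `I` is a simple ideal of `[A, A]`, or the non-trivial centre of `A`. -/
def IsIdealSummand (I : LieIdeal ℝ A) : Prop :=
  (I ≤ ⁅(⊤ : LieIdeal ℝ A), (⊤ : LieIdeal ℝ A)⁆ ∧ LieAlgebra.IsSimple ℝ I) ∨
    (I = LieAlgebra.center ℝ A ∧ LieAlgebra.center ℝ A ≠ ⊥)

theorem lie_eq_zero_of_inf_eq_bot {I J : LieIdeal ℝ A} (h : I ⊓ J = ⊥) {x y : A} (hx : x ∈ I)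
    (hy : y ∈ J) : ⁅x, y⁆ = 0 := by
  have : ⁅x, y⁆ ∈ I ⊓ J := ⟨lie_mem_left ℝ A I x y hx, lie_mem_right ℝ A J x y hy⟩
  rwa [h, LieSubmodule.mem_bot] at this

theorem IsSimple.le_or_inf_eq_bot {I : LieIdeal ℝ A} (hI : LieAlgebra.IsSimple ℝ I)
    (J : LieIdeal ℝ A) : I ≤ J ∨ I ⊓ J = ⊥ := by
  rcases hI.eq_bot_or_eq_top (J.comap I.incl) with h | h
  · right
    rw [eq_bot_iff]
    rintro x ⟨hx, hxJ⟩
    have : (⟨x, hx⟩ : I) ∈ J.comap I.incl := by rw [LieIdeal.mem_comap]; exact hxJ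
    rw [h, LieSubmodule.mem_bot] at this
    simpa using this
  · left
    intro x hx
    have : (⟨x, hx⟩ : I) ∈ J.comap I.incl := by rw [h]; exact LieSubmodule.mem_top _
    rw [LieIdeal.mem_comap] at this
    exact this

theorem IsSimple.not_le_center {I : LieIdeal ℝ A} (hI : LieAlgebra.IsSimple ℝ I) :
    ¬ I ≤ LieAlgebra.center ℝ A := by
  intro h
  apply hI.non_abelian
  refine ⟨fun x y => Subtype.ext ?_⟩
  have := (LieModule.mem_maxTrivSubmodule ℝ A A (y : A)).1 (h y.2) (x : A)
  simpa using this

theorem IsIdealSummand.inf_eq_bot {I J : LieIdeal ℝ A} (hI : IsIdealSummand I)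
    (hJ : IsIdealSummand J) (h : I ≠ J) : I ⊓ J = ⊥ := by
  rcases hI with ⟨-, hI⟩ | ⟨rfl, -⟩
  · rcases IsSimple.le_or_inf_eq_bot hI J with h1 | h1
    · rcases hJ with ⟨-, hJ⟩ | ⟨rfl, -⟩
      · rcases IsSimple.le_or_inf_eq_bot hJ I with h2 | h2
        · exact absurd (le_antisymm h1 h2) h
        · rwa [inf_comm]
      · exact absurd h1 (IsSimple.not_le_center hI)
    · exact h1
  · rcases hJ with ⟨-, hJ⟩ | ⟨rfl, -⟩
    · rw [inf_comm]
      exact (IsSimple.le_or_inf_eq_bot hJ _).resolve_left (IsSimple.not_le_center hJ)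
    · exact absurd rfl h

variable (h : LinearMap.BilinForm ℝ A) (hs : ∀ x y, h x y = h y x)
  (hi : ∀ x y z : A, h ⁅x, y⁆ z = - h y ⁅x, z⁆)

include hi in
-- The part of `I` orthogonal to `J` is an ideal of `I`. It contains `[I, I]`, because `[I, J] ⊆ I ⊓
-- J = 0`, so it cannot be zero.
theorem IsSimple.orthogonal_of_inf_eq_bot {I J : LieIdeal ℝ A} (hI : LieAlgebra.IsSimple ℝ I)
    (hIJ : I ⊓ J = ⊥) {x y : A} (hx : x ∈ I) (hy : y ∈ J) : h x y = 0 := by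
  let N : LieIdeal ℝ I :=
    { carrier := {x | ∀ z ∈ J, h x z = 0}
      add_mem' := fun ha hb z hz => by simp [ha z hz, hb z hz]
      zero_mem' := by simp
      smul_mem' := fun c a ha z hz => by simp [ha z hz]
      lie_mem := fun {a b} hb z hz => by
        have := hb ⁅(a : A), z⁆ (lie_mem_right ℝ A J _ _ hz)
        change h ⁅(a : A), (b : A)⁆ z = 0
        rw [hi, this, neg_zero] }
  have hN : ∀ a : I, a ∈ N ↔ ∀ z ∈ J, h a z = 0 := fun a => Iff.rfl
  rcases hI.eq_bot_or_eq_top N with h1 | h1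
  · exfalso
    apply hI.non_abelian
    refine ⟨fun a b => ?_⟩
    rw [← LieSubmodule.mem_bot (R := ℝ) (L := I), ← h1, hN]
    intro z hz
    change h ⁅(a : A), (b : A)⁆ z = 0
    rw [hi, lie_eq_zero_of_inf_eq_bot hIJ a.2 hz, map_zero, neg_zero]
  · have : (⟨x, hx⟩ : I) ∈ N := by rw [h1]; exact LieSubmodule.mem_top _
    exact (hN _).1 this y hy

include hs hi in
theorem IsIdealSummand.orthogonal {I J : LieIdeal ℝ A} (hI : IsIdealSummand I)
    (hJ : IsIdealSummand J) (hIJ : I ≠ J) {x y : A} (hx : x ∈ I) (hy : y ∈ J) : h x y = 0 := by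
  have hb := hI.inf_eq_bot hJ hIJ
  rcases hI with ⟨-, hI⟩ | ⟨rfl, -⟩
  · exact IsSimple.orthogonal_of_inf_eq_bot h hi hI hb hx hy
  · rcases hJ with ⟨-, hJ⟩ | ⟨rfl, -⟩
    · rw [hs]
      exact IsSimple.orthogonal_of_inf_eq_bot h hi hJ (by rwa [inf_comm]) hy hx
    · exact absurd rfl hIJ

variable [Module.Finite ℝ A] (hp : ∀ x, x ≠ 0 → 0 < h x x)

include hs hi hp in
-- For simple `I`, an eigenspace of its Killing form relative to `h` is a nonzero ideal, hence
-- everything. The Killing form of the centre is zero.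
theorem IsIdealSummand.exists_killingForm_eq {I : LieIdeal ℝ A} (hI : IsIdealSummand I) :
    ∃ c : ℝ, ∀ x y : I, killingForm ℝ I x y = c * h x y := by
  rcases hI with ⟨-, hI⟩ | ⟨rfl, -⟩
  · have : Nontrivial I := by
      by_contra hn
      rw [not_nontrivial_iff_subsingleton] at hn
      exact hI.non_abelian ⟨fun a b => Subsingleton.elim _ _⟩
    obtain ⟨μ, v, hv, hμ⟩ := exists_eigenvector (V := I) (h.restrict I.toSubmodule)
      (fun x y => hs x y) (fun x hx => hp x (by simpa using hx)) (killingForm ℝ I)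
      killingForm_symm
    let N : LieIdeal ℝ I :=
      { carrier := {x | ∀ w : I, killingForm ℝ I x w = μ * h x w}
        add_mem' := fun ha hb z => by simp [ha z, hb z, mul_add]
        zero_mem' := by simp
        smul_mem' := fun c a ha z => by simp [ha z]; ring
        lie_mem := fun {a b} hb z => by
          have := hb ⁅a, z⁆
          change killingForm ℝ I ⁅a, b⁆ z = μ * h ⁅(a : A), (b : A)⁆ z
          rw [killingForm_lie', this, hi, mul_neg]; rfl }
    have hN : ∀ a : I, a ∈ N ↔ ∀ w : I, killingForm ℝ I a w = μ * h a w := fun a => Iff.rfl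
    rcases hI.eq_bot_or_eq_top N with h1 | h1
    · have : v ∈ N := hμ
      rw [h1, LieSubmodule.mem_bot] at this
      exact absurd this hv
    · exact ⟨μ, fun x => (hN x).1 (by rw [h1]; exact LieSubmodule.mem_top _)⟩
  · refine ⟨0, fun x y => ?_⟩
    simp

include hs hi hp in
-- If the orthogonal complement `N` of the sum `J` were nonzero, it would contain a minimal ideal.
-- That ideal is central if abelian and a simple ideal of `[A, A]` otherwise. Either way it lies in
-- `J` as well, contradicting `J ⊓ N = 0`.
theorem sSup_isIdealSummand : sSup {I : LieIdeal ℝ A | IsIdealSummand I} = ⊤ := by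
  set J := sSup {I : LieIdeal ℝ A | IsIdealSummand I} with hJ
  have hcompl : ∀ I : LieIdeal ℝ A,
      IsCompl I.toSubmodule (LieAlgebra.InvariantForm.orthogonal h hi I).toSubmodule := fun I =>
    isCompl_orthogonal_of_ne_zero h hs I.toSubmodule fun w _ hw => (hp w hw).ne'
  set N := LieAlgebra.InvariantForm.orthogonal h hi J with hN
  have hdisj : ∀ I : LieIdeal ℝ A, I ≤ N → IsIdealSummand I → I = ⊥ := by
    intro I h1 h2
    have h3 : I ≤ J := le_sSup h2
    rw [eq_bot_iff]
    intro x hx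
    have := (Submodule.disjoint_def.1 (hcompl J).disjoint) x (h3 hx) (h1 hx)
    rw [LieSubmodule.mem_bot, this]
  have hNbot : N = ⊥ := by
    by_contra hne
    obtain ⟨I, hI, hIN⟩ := (eq_bot_or_exists_atom_le N).resolve_left hne
    have hzero : ∀ x ∈ I, ∀ y ∈ LieAlgebra.InvariantForm.orthogonal h hi I, ⁅y, x⁆ = 0 := by
      intro x hx y hy
      refine Submodule.disjoint_def.1 (hcompl I).disjoint _ (lie_mem_right ℝ A I _ _ hx)
        (lie_mem_left ℝ A _ _ _ hy)
    by_cases hab : IsLieAbelian I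
    · have hc : I ≤ LieAlgebra.center ℝ A := by
        intro x hx
        rw [LieModule.mem_maxTrivSubmodule]
        intro y
        obtain ⟨u, hu, v, hv, rfl⟩ := Submodule.mem_sup.1 ((hcompl I).sup_eq_top ▸
          Submodule.mem_top (x := y))
        rw [add_lie, hzero x hx v hv, add_zero]
        exact congrArg Subtype.val (hab.trivial (⟨u, hu⟩ : I) (⟨x, hx⟩ : I))
      have hcne : LieAlgebra.center ℝ A ≠ ⊥ := fun hb => hI.1 (eq_bot_iff.2 (hb ▸ hc))
      have h3 : I ≤ J := hc.trans (le_sSup (Or.inr ⟨rfl, hcne⟩))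
      apply hI.1
      rw [eq_bot_iff]
      intro x hx
      have := (Submodule.disjoint_def.1 (hcompl J).disjoint) x (h3 hx) (hIN hx)
      rw [LieSubmodule.mem_bot, this]
    · have hle : I ≤ ⁅(⊤ : LieIdeal ℝ A), (⊤ : LieIdeal ℝ A)⁆ := by
        rcases hI.le_iff.1 (LieSubmodule.lie_le_right I I) with h1 | h1
        · exfalso
          apply hab
          refine ⟨fun x y => Subtype.ext ?_⟩
          have : ⁅(x : A), (y : A)⁆ ∈ ⁅I, I⁆ := LieSubmodule.lie_mem_lie x.2 y.2
          rwa [h1, LieSubmodule.mem_bot] at this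
        · rw [← h1]; exact LieSubmodule.mono_lie le_top le_top
      refine hI.1 (hdisj I hIN (Or.inl ⟨hle, ⟨fun M => ?_, hab⟩⟩))
      -- An ideal of `I` is an ideal of `A`, since `A = I + I^⊥` and `I^⊥` commutes with `I`.
      -- Minimality of `I` thus makes it simple.
      let M' : LieIdeal ℝ A :=
        { M.toSubmodule.map I.toSubmodule.subtype with
          lie_mem := by
            rintro y _ ⟨x, hx, rfl⟩
            obtain ⟨u, hu, v, hv, rfl⟩ := Submodule.mem_sup.1 ((hcompl I).sup_eq_top ▸
              Submodule.mem_top (x := y))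
            rw [add_lie, Submodule.subtype_apply, hzero _ x.2 v hv, add_zero]
            exact ⟨⁅(⟨u, hu⟩ : I), x⁆, lie_mem_right ℝ I M _ _ hx, rfl⟩ }
      have hM' : ∀ x, x ∈ M' ↔ ∃ y ∈ M, (y : A) = x := fun x => Iff.rfl
      have hMI : M' ≤ I := by
        intro x hx
        obtain ⟨y, -, rfl⟩ := (hM' x).1 hx
        exact y.2
      rcases hI.le_iff.1 hMI with h1 | h1
      · left
        rw [eq_bot_iff]
        intro x hx
        have : (x : A) ∈ M' := (hM' _).2 ⟨x, hx, rfl⟩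
        rw [h1, LieSubmodule.mem_bot] at this
        rw [LieSubmodule.mem_bot]
        exact Subtype.ext this
      · right
        rw [eq_top_iff]
        intro x _
        have hxM : (x : A) ∈ M' := by rw [h1]; exact x.2
        obtain ⟨y, hy, hyx⟩ := (hM' x).1 hxM
        rwa [← Subtype.ext hyx]
  have h1 := (hcompl J).sup_eq_top
  rw [← hN, hNbot, LieSubmodule.bot_toSubmodule, sup_bot_eq] at h1
  rwa [LieSubmodule.toSubmodule_eq_top] at h1

end Compact

/-! ### Signs of the Killing form on `𝔭` and `𝔨`, and existence of an adapted frame -/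

section

variable {L : Type*} [LieRing L] [LieAlgebra ℝ L] {𝔨 : LieSubalgebra ℝ L}

theorem mem_killingPerp {x : L} : x ∈ killingPerp 𝔨 ↔ ∀ k ∈ 𝔨, killingForm ℝ L k x = 0 :=
  Iff.rfl

theorem lie_mem_killingPerp {k x : L} (hk : k ∈ 𝔨) (hx : x ∈ killingPerp 𝔨) :
    ⁅k, x⁆ ∈ killingPerp 𝔨 := by
  rw [mem_killingPerp] at *
  intro l hl
  rw [← killingForm_lie]
  exact hx _ (𝔨.lie_mem hl hk)

/-- The orthogonal complement of `𝔨`, as a module over `𝔨`. -/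
def perpModule (𝔨 : LieSubalgebra ℝ L) : LieSubmodule ℝ 𝔨 L :=
  { killingPerp 𝔨 with lie_mem := fun {k _} hx => lie_mem_killingPerp k.2 hx }

theorem exists_add_of_isCompl (hc : IsCompl (killingPerp 𝔨) 𝔨.toSubmodule) (u : L) :
    ∃ x ∈ killingPerp 𝔨, ∃ k ∈ 𝔨, x + k = u :=
  Submodule.mem_sup.1 (hc.sup_eq_top ▸ Submodule.mem_top)

/-- The centralizer of `𝔭` in `𝔨` is an ideal of `L`. It is not all of `L`, as `𝔭 ≠ 0` meets `𝔨`
trivially. -/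
theorem eq_zero_of_lie_killingPerp (hL : LieAlgebra.IsSimple ℝ L)
    (hc : IsCompl (killingPerp 𝔨) 𝔨.toSubmodule) (hne : killingPerp 𝔨 ≠ ⊥) {k : L} (hk : k ∈ 𝔨)
    (h : ∀ x ∈ killingPerp 𝔨, ⁅k, x⁆ = 0) : k = 0 := by
  let N : LieIdeal ℝ L :=
    { carrier := {k | k ∈ 𝔨 ∧ ∀ x ∈ killingPerp 𝔨, ⁅k, x⁆ = 0}
      add_mem' := fun ha hb => ⟨add_mem ha.1 hb.1, fun x hx => by
        rw [add_lie, ha.2 x hx, hb.2 x hx, add_zero]⟩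
      zero_mem' := ⟨zero_mem _, by simp⟩
      smul_mem' := fun c a ha => ⟨𝔨.smul_mem c ha.1, fun x hx => by
        rw [smul_lie, ha.2 x hx, smul_zero]⟩
      lie_mem := fun {u m} hm => by
        obtain ⟨x, hx, l, hl, rfl⟩ := exists_add_of_isCompl hc u
        rw [add_lie, ← lie_skew x m, hm.2 x hx, neg_zero, zero_add]
        refine ⟨𝔨.lie_mem hl hm.1, fun y hy => ?_⟩
        rw [lie_lie, hm.2 y hy, hm.2 _ (lie_mem_killingPerp hl hy)]
        simp }
  have hN : ∀ m, m ∈ N ↔ m ∈ 𝔨 ∧ ∀ x ∈ killingPerp 𝔨, ⁅m, x⁆ = 0 := fun _ => Iff.rfl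
  rcases hL.eq_bot_or_eq_top N with h1 | h1
  · have : k ∈ N := (hN k).2 ⟨hk, h⟩
    rwa [h1, LieSubmodule.mem_bot] at this
  · exfalso
    apply hne
    rw [eq_bot_iff]
    intro x hx
    have hxN : x ∈ N := by rw [h1]; exact LieSubmodule.mem_top _
    exact Submodule.disjoint_def.1 hc.disjoint x hx ((hN x).1 hxN).1

variable [Module.Finite ℝ L]

/-- `B(k, k)` splits into `tr (ad k)²` over `𝔭` and over `𝔨`. On `𝔭`, `ad k` is nonzero and skew for
`B > 0`, so that trace is negative. Hence the negated trace form of `𝔭` is an invariant positive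
form on `𝔨`; `ad k` is skew for it, and the second trace is nonpositive. -/
theorem killingForm_neg_of_pos_on_killingPerp (hL : LieAlgebra.IsSimple ℝ L)
    (hc : IsCompl (killingPerp 𝔨) 𝔨.toSubmodule) (hne : killingPerp 𝔨 ≠ ⊥)
    (hp : ∀ x ∈ killingPerp 𝔨, x ≠ 0 → 0 < killingForm ℝ L x x) {k : L} (hk : k ∈ 𝔨)
    (hk0 : k ≠ 0) : killingForm ℝ L k k < 0 := by
  let h : LinearMap.BilinForm ℝ 𝔨 := - LieModule.traceForm ℝ 𝔨 (perpModule 𝔨)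
  have happ : ∀ a b, h a b = - trace ℝ _ (LieModule.toEnd ℝ 𝔨 (perpModule 𝔨) a *
    LieModule.toEnd ℝ 𝔨 (perpModule 𝔨) b) := fun a b => rfl
  have hneg : ∀ a : 𝔨, a ≠ 0 → trace ℝ _ (LieModule.toEnd ℝ 𝔨 (perpModule 𝔨) a *
      LieModule.toEnd ℝ 𝔨 (perpModule 𝔨) a) < 0 := by
    intro a ha
    refine trace_mul_self_neg_of_skew (V := killingPerp 𝔨)
      ((killingForm ℝ L).restrict (killingPerp 𝔨)) (fun x y => killingForm_symm _ _)
      (fun x hx => hp x x.2 (by simpa using hx)) (LieModule.toEnd ℝ 𝔨 (perpModule 𝔨) a)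
      (fun x y => killingForm_lie' _ _ _) ?_
    intro h0
    apply ha
    refine Subtype.ext (eq_zero_of_lie_killingPerp hL hc hne a.2 fun x hx => ?_)
    exact congrArg Subtype.val (LinearMap.congr_fun h0 ⟨x, hx⟩)
  have hk' : trace ℝ 𝔨 (ad ℝ 𝔨 ⟨k, hk⟩ * ad ℝ 𝔨 ⟨k, hk⟩) ≤ 0 := by
    refine trace_mul_self_nonpos_of_skew h (fun x y => ?_) (fun x hx => ?_) _ (fun x y => ?_)
    · simp only [h, LinearMap.neg_apply, LieModule.traceForm_comm ℝ 𝔨 _ x y]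
    · rw [happ]; linarith [hneg x hx]
    · simp only [h, LinearMap.neg_apply, LieAlgebra.ad_apply]
      rw [LieModule.traceForm_apply_lie_apply' ℝ 𝔨]
  have hdec := trace_eq_add_of_isCompl hc (ad ℝ L k * ad ℝ L k)
    (fun x hx => lie_mem_killingPerp hk (lie_mem_killingPerp hk hx))
    (fun x hx => 𝔨.lie_mem hk (𝔨.lie_mem hk hx))
  rw [killingForm_apply_apply, ← Module.End.mul_eq_comp, hdec]
  have h1 := hneg ⟨k, hk⟩ (fun h0 => hk0 (congrArg Subtype.val h0))
  refine add_neg_of_neg_of_nonpos (lt_of_eq_of_lt ?_ h1) (le_of_eq_of_le ?_ hk')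
  · rfl
  · rfl

omit [Module.Finite ℝ L] in
theorem isSimple_of_equiv {A A' : Type*} [LieRing A] [LieAlgebra ℝ A] [LieRing A']
    [LieAlgebra ℝ A'] (e : A ≃ₗ⁅ℝ⁆ A') (hA : LieAlgebra.IsSimple ℝ A) :
    LieAlgebra.IsSimple ℝ A' where
  eq_bot_or_eq_top I := by
    rcases hA.eq_bot_or_eq_top (I.comap e.toLieHom) with h | h
    · left
      rw [eq_bot_iff]
      intro x hx
      have : e.symm x ∈ I.comap e.toLieHom := by
        rw [LieIdeal.mem_comap]; simpa using hx
      rw [h, LieSubmodule.mem_bot] at this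
      simpa using this
    · right
      rw [eq_top_iff]
      intro x _
      have : e.symm x ∈ I.comap e.toLieHom := by rw [h]; exact LieSubmodule.mem_top _
      rw [LieIdeal.mem_comap] at this
      simpa using this
  non_abelian h := hA.non_abelian ⟨fun x y => e.injective (by
    rw [LieHom.map_lie, map_zero]; exact h.trivial _ _)⟩

omit [Module.Finite ℝ L] in
theorem isSummand_top (hL : LieAlgebra.IsSimple ℝ L) (h𝔨 : 𝔨.toSubmodule = ⊤) :
    IsSummand 𝔨 ⊤ := by
  have h𝔨' : 𝔨 = ⊤ := by
    rw [eq_top_iff]; intro x _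
    have : x ∈ 𝔨.toSubmodule := by rw [h𝔨]; trivial
    exact this
  have hs : LieAlgebra.IsSimple ℝ 𝔨 := by
    subst h𝔨'
    exact isSimple_of_equiv (LieSubalgebra.topEquiv (R := ℝ) (L := L)).symm hL
  left
  refine ⟨?_, isSimple_of_equiv (LieIdeal.topEquiv (R := ℝ) (L := 𝔨)).symm hs⟩
  rcases hs.eq_bot_or_eq_top ⁅(⊤ : LieIdeal ℝ 𝔨), (⊤ : LieIdeal ℝ 𝔨)⁆ with h | h
  · exfalso
    apply hs.non_abelian
    refine ⟨fun x y => ?_⟩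
    have : ⁅x, y⁆ ∈ ⁅(⊤ : LieIdeal ℝ 𝔨), (⊤ : LieIdeal ℝ 𝔨)⁆ :=
      LieSubmodule.lie_mem_lie (LieSubmodule.mem_top x) (LieSubmodule.mem_top y)
    rwa [h, LieSubmodule.mem_bot] at this
  · rw [h]

omit [Module.Finite ℝ L] in
theorem mem_ambient {I : LieIdeal ℝ 𝔨} {x : L} : x ∈ ambient I ↔ ∃ k ∈ I, (k : L) = x :=
  Iff.rfl

theorem killingForm_neg_of_summands (hL : LieAlgebra.IsSimple ℝ L)
    (hc : IsCompl (killingPerp 𝔨) 𝔨.toSubmodule)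
    (hp : ∀ x ∈ killingPerp 𝔨, x ≠ 0 → 0 < killingForm ℝ L x x)
    (hk : ∀ I, IsSummand 𝔨 I → ∀ x ∈ ambient I, x ≠ 0 → killingForm ℝ L x x < 0)
    {k : L} (hk' : k ∈ 𝔨) (hk0 : k ≠ 0) : killingForm ℝ L k k < 0 := by
  -- If `𝔭 = 0` then `𝔨 = L` is simple, so it is itself one of the summands.
  by_cases hne : killingPerp 𝔨 = ⊥
  · refine hk ⊤ (isSummand_top hL ?_) k (mem_ambient.2 ⟨⟨k, hk'⟩, LieSubmodule.mem_top _, rfl⟩) hk0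
    have := hc.sup_eq_top
    rwa [hne, bot_sup_eq] at this
  · exact killingForm_neg_of_pos_on_killingPerp hL hc hne hp hk' hk0

/-- The positive definite invariant form `-B` on `𝔨`. -/
def negKilling (𝔨 : LieSubalgebra ℝ L) : LinearMap.BilinForm ℝ 𝔨 :=
  -(killingForm ℝ L).restrict 𝔨.toSubmodule

omit [Module.Finite ℝ L] in
theorem negKilling_apply (x y : 𝔨) : negKilling 𝔨 x y = - killingForm ℝ L x y := rfl

theorem negKilling_symm (x y : 𝔨) : negKilling 𝔨 x y = negKilling 𝔨 y x := by
  rw [negKilling_apply, negKilling_apply, killingForm_symm]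

theorem negKilling_lie (x y z : 𝔨) : negKilling 𝔨 ⁅x, y⁆ z = - negKilling 𝔨 y ⁅x, z⁆ := by
  rw [negKilling_apply, negKilling_apply, neg_neg]
  exact (neg_eq_iff_eq_neg.2 (killingForm_lie' _ _ _))

section Neg

variable (hneg : ∀ k ∈ 𝔨, k ≠ 0 → killingForm ℝ L k k < 0)
include hneg

theorem negKilling_pos (x : 𝔨) (hx : x ≠ 0) : 0 < negKilling 𝔨 x x := by
  rw [negKilling_apply, neg_pos]
  exact hneg x x.2 (by simpa using hx)

theorem killingForm_eq_kappa {I : LieIdeal ℝ 𝔨} (hI : IsSummand 𝔨 I) (x y : I) :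
    killingForm ℝ I x y = kappa I * killingForm ℝ L ((x : 𝔨) : L) ((y : 𝔨) : L) := by
  obtain ⟨c, hcc⟩ := IsIdealSummand.exists_killingForm_eq (negKilling 𝔨) negKilling_symm
    negKilling_lie (negKilling_pos hneg) hI
  have h : ∃ c : ℝ, ∀ x y : I,
      killingForm ℝ I x y = c * killingForm ℝ L ((x : 𝔨) : L) ((y : 𝔨) : L) :=
    ⟨-c, fun x y => by rw [hcc, negKilling_apply]; ring⟩
  rw [kappa, dif_pos h]
  exact h.choose_spec x y

omit hneg in
theorem killingForm_ambient_eq_zero {I J : LieIdeal ℝ 𝔨} (hI : IsSummand 𝔨 I)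
    (hJ : IsSummand 𝔨 J) (hIJ : I ≠ J) {x y : L} (hx : x ∈ ambient I) (hy : y ∈ ambient J) :
    killingForm ℝ L x y = 0 := by
  obtain ⟨x, hx', rfl⟩ := mem_ambient.1 hx
  obtain ⟨y, hy', rfl⟩ := mem_ambient.1 hy
  have := IsIdealSummand.orthogonal (negKilling 𝔨) negKilling_symm negKilling_lie hI hJ hIJ hx' hy'
  rwa [negKilling_apply, neg_eq_zero] at this

theorem iSup_ambient {ι : Type*} (𝔨i : ι → LieIdeal ℝ 𝔨)
    (h𝔨i : ∀ I : LieIdeal ℝ 𝔨, I ∈ Set.range 𝔨i ↔ IsSummand 𝔨 I) :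
    ⨆ i, ambient (𝔨i i) = 𝔨.toSubmodule := by
  have h1 : ⨆ i, 𝔨i i = ⊤ := by
    rw [← sSup_isIdealSummand (negKilling 𝔨) negKilling_symm negKilling_lie (negKilling_pos hneg),
      ← sSup_range]
    congr 1
    ext I
    exact h𝔨i I
  have h2 : ⨆ i, (𝔨i i).toSubmodule = ⊤ := by
    rw [← LieSubmodule.iSup_toSubmodule, h1, LieSubmodule.top_toSubmodule]
  simp only [ambient]
  rw [← Submodule.map_iSup, h2, Submodule.map_top, Submodule.range_subtype]

theorem exists_killingFrame {ι : Type*} [Fintype ι] (𝔨i : ι → LieIdeal ℝ 𝔨)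
    (h𝔨i_inj : Function.Injective 𝔨i)
    (h𝔨i : ∀ I : LieIdeal ℝ 𝔨, I ∈ Set.range 𝔨i ↔ IsSummand 𝔨 I)
    (hc : IsCompl (killingPerp 𝔨) 𝔨.toSubmodule)
    (hp : ∀ x ∈ killingPerp 𝔨, x ≠ 0 → 0 < killingForm ℝ L x x) :
    ∃ f : KillingFrame L (Fin (Module.finrank ℝ (killingPerp 𝔨)))
        (Σ i, Fin (Module.finrank ℝ (𝔨i i))),
      (∀ a, f.e a ∈ killingPerp 𝔨) ∧ ∀ i b, f.c ⟨i, b⟩ ∈ ambient (𝔨i i) := by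
  have hsum : ∀ i, IsSummand 𝔨 (𝔨i i) := fun i => (h𝔨i _).1 ⟨i, rfl⟩
  have horth : ∀ i j, i ≠ j → ∀ x ∈ ambient (𝔨i i), ∀ y ∈ ambient (𝔨i j),
      killingForm ℝ L x y = 0 := fun i j hij x hx y hy =>
    killingForm_ambient_eq_zero (hsum i) (hsum j) (h𝔨i_inj.ne hij) hx hy
  obtain ⟨e, he⟩ := exists_orthonormal_basis ((killingForm ℝ L).restrict (killingPerp 𝔨))
    (fun x y => killingForm_symm _ _) (fun x hx => hp x x.2 (by simpa using hx))
  choose b hb using fun i => exists_orthonormal_basis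
    ((negKilling 𝔨).restrict (𝔨i i).toSubmodule)
    (fun x y => negKilling_symm _ _)
    (fun x hx => negKilling_pos hneg x (by simpa using hx))
  let c : (Σ i, Fin (Module.finrank ℝ (𝔨i i))) → L := fun p => ((b p.1 p.2 : 𝔨i p.1) : 𝔨)
  have hcmem : ∀ i a, c ⟨i, a⟩ ∈ ambient (𝔨i i) := fun i a => mem_ambient.2 ⟨_, (b i a).2, rfl⟩
  have hc𝔨 : ∀ p, c p ∈ 𝔨 := fun p => ((b p.1 p.2 : 𝔨i p.1) : 𝔨).2
  have hcc : ∀ i a a', killingForm ℝ L (c ⟨i, a⟩) (c ⟨i, a'⟩) = if a = a' then -1 else 0 := by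
    intro i a a'
    have h1 : -killingForm ℝ L (c ⟨i, a⟩) (c ⟨i, a'⟩) = if a = a' then 1 else 0 := hb i a a'
    rw [← neg_neg (killingForm ℝ L _ _), h1]
    split_ifs <;> simp
  have hee : ∀ a a', killingForm ℝ L (e a : L) (e a' : L) = if a = a' then 1 else 0 := he
  -- The error in the frame expansion. It vanishes on `𝔭` and on each `𝔨ᵢ`, and these span `L`.
  let Φ : Module.End ℝ L := ∑ a, ((killingForm ℝ L).flip (e a : L)).smulRight (e a : L)
    - ∑ i, ((killingForm ℝ L).flip (c i)).smulRight (c i) - 1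
  have hΦ : ∀ u, Φ u = ∑ a, killingForm ℝ L u (e a) • (e a : L)
      - ∑ i, killingForm ℝ L u (c i) • c i - u := fun u => by
    simp [Φ, LinearMap.sum_apply]
  have hΦp : killingPerp 𝔨 ≤ LinearMap.ker Φ := by
    intro x hx
    rw [LinearMap.mem_ker, hΦ, Finset.sum_eq_zero (s := Finset.univ)
      (f := fun i => killingForm ℝ L x (c i) • c i), sub_zero, sub_eq_zero]
    · have h1 := congrArg (killingPerp 𝔨).subtype (e.sum_repr ⟨x, hx⟩)
      simp only [map_sum, map_smul, Submodule.subtype_apply] at h1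
      have h2 : ∀ a, killingForm ℝ L x (e a) = e.repr ⟨x, hx⟩ a := by
        intro a
        conv_lhs => rw [← h1]
        simp [LinearMap.sum_apply, hee, -Module.Basis.sum_repr]
      simp only [h2, h1]
    · intro i _
      rw [killingForm_symm, hx _ (hc𝔨 i), zero_smul]
  have hΦk : ∀ i, ambient (𝔨i i) ≤ LinearMap.ker Φ := by
    intro i x hx
    obtain ⟨y, hy, rfl⟩ := mem_ambient.1 hx
    rw [LinearMap.mem_ker, hΦ, Finset.sum_eq_zero (s := Finset.univ)
      (f := fun a => killingForm ℝ L y (e a) • (e a : L)), zero_sub, Fintype.sum_sigma,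
      Finset.sum_eq_single i]
    · have h3 := congrArg (𝔨.toSubmodule.subtype ∘ₗ (𝔨i i).toSubmodule.subtype)
        ((b i).sum_repr ⟨y, hy⟩)
      simp only [map_sum, map_smul] at h3
      change ∑ a, (b i).repr ⟨y, hy⟩ a • c ⟨i, a⟩ = (y : L) at h3
      have h2 : ∀ a, killingForm ℝ L y (c ⟨i, a⟩) = -(b i).repr ⟨y, hy⟩ a := by
        intro a
        conv_lhs => rw [← h3]
        simp [LinearMap.sum_apply, hcc]
      simp only [h2, neg_smul, Finset.sum_neg_distrib, neg_neg]
      exact sub_eq_zero.2 h3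
    · intro j _ hj
      exact Finset.sum_eq_zero fun a _ => by
        rw [horth i j hj.symm _ hx _ (hcmem j a), zero_smul]
    · simp
    · intro a _
      rw [(e a).2 _ y.2, zero_smul]
  have hΦtop : LinearMap.ker Φ = ⊤ := by
    rw [eq_top_iff, ← hc.sup_eq_top, ← iSup_ambient hneg 𝔨i h𝔨i]
    exact sup_le hΦp (iSup_le hΦk)
  refine ⟨{
    e := fun a => e a
    c := c
    e_e_self := fun a => by rw [hee, if_pos rfl]
    e_e := fun a a' h => by rw [hee, if_neg h]
    c_c_self := fun ⟨i, a⟩ => by rw [hcc, if_pos rfl]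
    c_c := fun ⟨i, a⟩ ⟨j, a'⟩ h => by
      by_cases hij : i = j
      · subst hij
        rw [hcc, if_neg (fun h0 => h (by rw [h0]))]
      · exact horth i j hij _ (hcmem i a) _ (hcmem j a')
    e_c := fun a i => by rw [killingForm_symm]; exact (e a).2 _ (hc𝔨 i)
    expand := fun u => by
      have : u ∈ LinearMap.ker Φ := by rw [hΦtop]; trivial
      rw [LinearMap.mem_ker, hΦ, sub_eq_zero] at this
      exact this.symm
    lie_c := fun i j a => (e a).2 _ (𝔨.lie_mem (hc𝔨 i) (hc𝔨 j)) }, fun a => (e a).2, hcmem⟩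

end Neg

end

/-! ### Projections to the ideals, irreducibility of `𝔭`, and the constants `dᵢ (1 - κᵢ) / n` -/

section

variable {L : Type*} [LieRing L] [LieAlgebra ℝ L]

theorem KillingFrame.hom_ext {n κ : Type*} [Fintype n] [Fintype κ] (f : KillingFrame L n κ)
    {N : Type*} [AddCommGroup N] [Module ℝ N] {F G : L →ₗ[ℝ] N}
    (he : ∀ a, F (f.e a) = G (f.e a)) (hc : ∀ i, F (f.c i) = G (f.c i)) : F = G := by
  ext u
  rw [f.expand u]
  simp only [map_sub, map_sum, map_smul, he, hc]

variable {𝔨 : LieSubalgebra ℝ L} {n : Type*} [Fintype n] {ι : Type*} [Fintype ι]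
  {𝔨i : ι → LieIdeal ℝ 𝔨} {m : ι → Type*} [∀ i, Fintype (m i)]

theorem ambient_le (I : LieIdeal ℝ 𝔨) {x : L} (hx : x ∈ ambient I) : x ∈ 𝔨 := by
  obtain ⟨y, -, rfl⟩ := mem_ambient.1 hx
  exact y.2

theorem lie_mem_ambient {I : LieIdeal ℝ 𝔨} {k x : L} (hk : k ∈ 𝔨) (hx : x ∈ ambient I) :
    ⁅k, x⁆ ∈ ambient I := by
  obtain ⟨y, hy, rfl⟩ := mem_ambient.1 hx
  exact mem_ambient.2 ⟨⁅(⟨k, hk⟩ : 𝔨), y⁆, lie_mem_right ℝ 𝔨 I _ _ hy, rfl⟩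

/-- The frame `f` consists of vectors of `𝔭` and of the pairwise orthogonal ideals `𝔨ᵢ`. -/
structure KillingFrame.IsAdapted (f : KillingFrame L n (Σ i, m i)) (𝔨i : ι → LieIdeal ℝ 𝔨) :
    Prop where
  e_mem : ∀ a, f.e a ∈ killingPerp 𝔨
  c_mem : ∀ i b, f.c ⟨i, b⟩ ∈ ambient (𝔨i i)
  orthogonal : ∀ i j, i ≠ j → ∀ x ∈ ambient (𝔨i i), ∀ y ∈ ambient (𝔨i j), killingForm ℝ L x y = 0

namespace KillingFrame.IsAdapted

variable {f : KillingFrame L n (Σ i, m i)} (hf : f.IsAdapted 𝔨i)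
include hf

theorem P_of_mem {x : L} (hx : x ∈ killingPerp 𝔨) : f.P x = x := by
  apply f.P_eq_self
  rw [K_apply, neg_eq_zero]
  exact Finset.sum_eq_zero fun ⟨i, b⟩ _ => by
    rw [hx _ (ambient_le _ (hf.c_mem i b)), zero_smul]

theorem K_of_mem {k : L} (hk : k ∈ 𝔨) : f.K k = k := by
  apply f.K_eq_self
  rw [P_apply]
  exact Finset.sum_eq_zero fun a _ => by
    rw [killingForm_symm, hf.e_mem a _ hk, zero_smul]

theorem P_mem (x : L) : f.P x ∈ killingPerp 𝔨 := by
  rw [P_apply]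
  exact Submodule.sum_mem _ fun a _ => Submodule.smul_mem _ _ (hf.e_mem a)

theorem K_mem (x : L) : f.K x ∈ 𝔨 := by
  rw [K_apply]
  exact neg_mem (sum_mem fun ⟨i, b⟩ _ => 𝔨.smul_mem _ (ambient_le _ (hf.c_mem i b)))

variable (f) in
omit hf in
/-- The projection to `𝔨ᵢ`. -/
def _root_.RicciNatRed.KillingFrame.proj (i : ι) : Module.End ℝ L :=
  -∑ b, (killingForm ℝ L (f.c ⟨i, b⟩)).smulRight (f.c ⟨i, b⟩)

omit hf in
theorem proj_apply (i : ι) (u : L) :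
    f.proj i u = -∑ b, killingForm ℝ L (f.c ⟨i, b⟩) u • f.c ⟨i, b⟩ := by
  simp [proj, LinearMap.sum_apply]

omit hf in
theorem K_eq_sum_proj : f.K = ∑ i, f.proj i := by
  ext u
  rw [LinearMap.sum_apply, K_apply, Fintype.sum_sigma]
  simp [proj_apply]

theorem proj_mem (i : ι) (u : L) : f.proj i u ∈ ambient (𝔨i i) := by
  rw [proj_apply]
  exact neg_mem (Submodule.sum_mem _ fun b _ => Submodule.smul_mem _ _ (hf.c_mem i b))

theorem proj_p (i : ι) {x : L} (hx : x ∈ killingPerp 𝔨) : f.proj i x = 0 := by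
  rw [proj_apply, neg_eq_zero]
  exact Finset.sum_eq_zero fun b _ => by
    rw [hx _ (ambient_le _ (hf.c_mem i b)), zero_smul]

theorem proj_of_ne {i j : ι} (hij : i ≠ j) {x : L} (hx : x ∈ ambient (𝔨i j)) :
    f.proj i x = 0 := by
  rw [proj_apply, neg_eq_zero]
  exact Finset.sum_eq_zero fun b _ => by
    rw [hf.orthogonal i j hij _ (hf.c_mem i b) _ hx, zero_smul]

theorem proj_self {i : ι} {x : L} (hx : x ∈ ambient (𝔨i i)) : f.proj i x = x := by
  have h := hf.K_of_mem (ambient_le _ hx)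
  rwa [K_eq_sum_proj, LinearMap.sum_apply, Finset.sum_eq_single i
    (fun j _ hj => hf.proj_of_ne hj hx) (by simp)] at h

theorem isEquivariant_proj (i : ι) : f.IsEquivariant (f.proj i) where
  K_mul := by
    ext u
    exact hf.K_of_mem (ambient_le _ (hf.proj_mem i u))
  mul_K := by
    ext u
    conv_rhs => rw [← f.P_apply_add_K_apply u, map_add, hf.proj_p i (hf.P_mem u), zero_add]
    rfl
  symm u v := by
    simp only [proj_apply, map_neg, LinearMap.neg_apply, map_sum, LinearMap.sum_apply, map_smul,
      LinearMap.smul_apply, smul_eq_mul]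
    exact congrArg _ <| Finset.sum_congr rfl fun a _ => by rw [killingForm_symm u]; ring
  comm k hk := by
    have hk' : k ∈ 𝔨 := hk ▸ hf.K_mem k
    apply f.hom_ext
    · intro a
      simp only [Module.End.mul_apply, LieAlgebra.ad_apply]
      rw [hf.proj_p i (lie_mem_killingPerp hk' (hf.e_mem a)), hf.proj_p i (hf.e_mem a), lie_zero]
    · rintro ⟨j, b⟩
      simp only [Module.End.mul_apply, LieAlgebra.ad_apply]
      by_cases hij : i = j
      · subst hij
        rw [hf.proj_self (hf.c_mem i b), hf.proj_self (lie_mem_ambient hk' (hf.c_mem i b))]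
      · rw [hf.proj_of_ne hij (hf.c_mem j b), hf.proj_of_ne hij (lie_mem_ambient hk' (hf.c_mem j b)),
          lie_zero]

variable (f) in
omit hf in
/-- The endomorphism acting by `w i` on `𝔨ᵢ` and by zero on `𝔭`. -/
def _root_.RicciNatRed.KillingFrame.scaling (w : ι → ℝ) : Module.End ℝ L := ∑ i, w i • f.proj i

omit hf in
theorem scaling_apply (w : ι → ℝ) (u : L) : f.scaling w u = ∑ i, w i • f.proj i u := by
  simp [scaling, LinearMap.sum_apply]

theorem scaling_self (w : ι → ℝ) {i : ι} {x : L} (hx : x ∈ ambient (𝔨i i)) :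
    f.scaling w x = w i • x := by
  rw [scaling_apply, Finset.sum_eq_single i, hf.proj_self hx]
  · intro j _ hj
    rw [hf.proj_of_ne hj hx, smul_zero]
  · simp

theorem isEquivariant_scaling (w : ι → ℝ) : f.IsEquivariant (f.scaling w) where
  K_mul := by
    simp only [scaling, Finset.mul_sum, mul_smul_comm, (hf.isEquivariant_proj _).K_mul]
  mul_K := by
    simp only [scaling, Finset.sum_mul, smul_mul_assoc, (hf.isEquivariant_proj _).mul_K]
  symm u v := by
    simp only [scaling_apply, map_sum, LinearMap.sum_apply, map_smul, LinearMap.smul_apply,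
      (hf.isEquivariant_proj _).symm]
  comm k hk := by
    simp only [scaling, Finset.mul_sum, Finset.sum_mul, smul_mul_assoc, mul_smul_comm,
      (hf.isEquivariant_proj _).comm k hk]

variable [Module.Finite ℝ L]

/-- The isotropy representation on `𝔭` is irreducible. -/
theorem killingPerp_le_of_invariant (hL : LieAlgebra.IsSimple ℝ L) {W : Submodule ℝ L}
    (hW : W ≤ killingPerp 𝔨) (hne : W ≠ ⊥) (hinv : ∀ k ∈ 𝔨, ∀ w ∈ W, ⁅k, w⁆ ∈ W) :
    killingPerp 𝔨 ≤ W := by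
  have hpp : ∀ x ∈ killingPerp 𝔨, ∀ y ∈ killingPerp 𝔨, ⁅x, y⁆ ∈ 𝔨 := fun x hx y hy => by
    rw [← f.K_lie_p_p (hf.P_of_mem hx) (hf.P_of_mem hy)]
    exact hf.K_mem _
  have hcompl : IsCompl W ((killingForm ℝ L).orthogonal W) :=
    isCompl_orthogonal_of_ne_zero _ killingForm_symm W fun w hw hw0 h0 =>
      hw0 (f.eq_zero_of_killingForm_self_nonpos (hf.P_of_mem (hW hw)) h0.le)
  -- `[x, w]` lies in `𝔨`, and `B(k, [x, w]) = -B([k, w], x) = 0` for all `k ∈ 𝔨` because `[k, w] ∈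
  -- W`.
  have horth : ∀ x ∈ killingPerp 𝔨, x ∈ (killingForm ℝ L).orthogonal W → ∀ w ∈ W,
      ⁅x, w⁆ = 0 := by
    intro x hx hxW w hw
    have h1 : f.K ⁅x, w⁆ = 0 := by
      rw [K_apply, neg_eq_zero]
      refine Finset.sum_eq_zero fun ⟨i, b⟩ _ => ?_
      have hcm := ambient_le _ (hf.c_mem i b)
      have : killingForm ℝ L (f.c ⟨i, b⟩) ⁅x, w⁆ = 0 := by
        rw [← lie_skew, map_neg, ← killingForm_lie, neg_eq_zero]
        exact hxW _ (hinv _ hcm w hw)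
      rw [this, zero_smul]
    rwa [f.K_lie_p_p (hf.P_of_mem hx) (hf.P_of_mem (hW hw))] at h1
  -- `W + [W, W]` is an ideal of `L`: by the Jacobi identity the complement of `W` in `𝔭` commutes
  -- with it. Simplicity makes it all of `L`, and its `𝔭`-part is `W`.
  let S : Submodule ℝ L := Submodule.span ℝ {z | ∃ a ∈ W, ∃ b ∈ W, ⁅a, b⁆ = z}
  have hS𝔨 : S ≤ 𝔨.toSubmodule := by
    rw [Submodule.span_le]
    rintro z ⟨a, ha, b, hb, rfl⟩
    exact hpp a (hW ha) b (hW hb)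
  have hdec : ∀ u : L, ∃ w ∈ W, ∃ x ∈ killingPerp 𝔨, x ∈ (killingForm ℝ L).orthogonal W ∧
      ∃ k ∈ 𝔨, u = w + x + k := by
    intro u
    obtain ⟨w, hw, x, hx, hwx⟩ := Submodule.mem_sup.1 (hcompl.sup_eq_top ▸
      Submodule.mem_top (x := f.P u))
    refine ⟨w, hw, x, ?_, hx, f.K u, hf.K_mem u, ?_⟩
    · rw [← add_sub_cancel_left w x, hwx]
      exact sub_mem (hf.P_mem u) (hW hw)
    · rw [hwx, f.P_apply_add_K_apply]
  let J : LieIdeal ℝ L :=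
    { W ⊔ S with
      lie_mem := by
        intro u z hz
        obtain ⟨w, hw, x, hxp, hx, k, hk, rfl⟩ := hdec u
        obtain ⟨a, ha, s, hs, rfl⟩ := Submodule.mem_sup.1 hz
        have hxs : ⁅x, s⁆ = 0 := by
          refine Submodule.span_induction (p := fun s _ => ⁅x, s⁆ = 0) ?_ (lie_zero x) ?_ ?_ hs
          · rintro _ ⟨a, ha, b, hb, rfl⟩
            rw [leibniz_lie, horth x hxp hx a ha, horth x hxp hx b hb, zero_lie, lie_zero, add_zero]
          · intro p q _ _ hp hq; rw [lie_add, hp, hq, add_zero]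
          · intro c p _ hp; rw [lie_smul, hp, smul_zero]
        have hks : ⁅k, s⁆ ∈ S := by
          refine Submodule.span_induction (p := fun s _ => ⁅k, s⁆ ∈ S) ?_ ?_ ?_ ?_ hs
          · rintro _ ⟨a, ha, b, hb, rfl⟩
            rw [leibniz_lie]
            exact add_mem (Submodule.subset_span ⟨_, hinv k hk a ha, b, hb, rfl⟩)
              (Submodule.subset_span ⟨a, ha, _, hinv k hk b hb, rfl⟩)
          · rw [lie_zero]; exact zero_mem _
          · intro p q _ _ hp hq; rw [lie_add]; exact add_mem hp hq
          · intro c p _ hp; rw [lie_smul]; exact Submodule.smul_mem _ _ hp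
        have hws : ⁅w, s⁆ ∈ W := by
          rw [← lie_skew]
          exact neg_mem (hinv s (hS𝔨 hs) w hw)
        have : ⁅w + x + k, a + s⁆ = (⁅w, s⁆ + ⁅k, a⁆) + (⁅w, a⁆ + ⁅k, s⁆) := by
          simp only [add_lie, lie_add, hxs, horth x hxp hx a ha]
          abel
        rw [this]
        exact Submodule.add_mem_sup (add_mem hws (hinv k hk a ha))
          (add_mem (Submodule.subset_span ⟨w, hw, a, ha, rfl⟩) hks) }
  have hJ : ∀ x, x ∈ J ↔ x ∈ W ⊔ S := fun _ => Iff.rfl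
  rcases hL.eq_bot_or_eq_top J with h1 | h1
  · exfalso
    apply hne
    rw [eq_bot_iff]
    intro x hx
    have : x ∈ J := (hJ x).2 (Submodule.mem_sup_left hx)
    rwa [h1, LieSubmodule.mem_bot] at this
  · intro x hx
    have hxJ : x ∈ J := by rw [h1]; exact LieSubmodule.mem_top _
    obtain ⟨a, ha, s, hs, rfl⟩ := Submodule.mem_sup.1 ((hJ x).1 hxJ)
    have hsp : s ∈ killingPerp 𝔨 := by simpa using sub_mem hx (hW ha)
    have hs0 : s = 0 := by
      rw [← hf.P_of_mem hsp, f.P_eq_zero (hf.K_of_mem (hS𝔨 hs))]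
    rwa [hs0, add_zero]

omit [Module.Finite ℝ L] hf in
/-- The form `(x, y) ↦ tr (M * ad x * ad y)`. -/
def traceAd (M : Module.End ℝ L) : LinearMap.BilinForm ℝ L :=
  LinearMap.mk₂ ℝ (fun x y => trace ℝ L (M * ad ℝ L x * ad ℝ L y))
    (fun x y z => by rw [← map_add, show ad ℝ L (x + y) = ad ℝ L x + ad ℝ L y by ext; simp,
      mul_add, add_mul])
    (fun c x z => by rw [← map_smul, show ad ℝ L (c • x) = c • ad ℝ L x by ext; simp,
      mul_smul_comm, smul_mul_assoc])
    (fun x y z => by rw [← map_add, show ad ℝ L (y + z) = ad ℝ L y + ad ℝ L z by ext; simp,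
      mul_add])
    (fun c x z => by rw [← map_smul, show ad ℝ L (c • z) = c • ad ℝ L z by ext; simp,
      mul_smul_comm])

omit [Module.Finite ℝ L] hf in
theorem traceAd_apply (M : Module.End ℝ L) (x y : L) :
    traceAd M x y = trace ℝ L (M * ad ℝ L x * ad ℝ L y) := rfl

omit [Module.Finite ℝ L] hf in
theorem traceAd_lie {M : Module.End ℝ L} (hM : f.IsEquivariant M) {k : L} (hk : f.K k = k)
    (x y : L) : traceAd M ⁅k, x⁆ y = - traceAd M x ⁅k, y⁆ := by
  rw [traceAd_apply, traceAd_apply, ad_lie, ad_lie, ← map_neg, ← sub_eq_zero, ← map_sub]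
  have h : M * (ad ℝ L k * ad ℝ L x - ad ℝ L x * ad ℝ L k) * ad ℝ L y -
      -(M * ad ℝ L x * (ad ℝ L k * ad ℝ L y - ad ℝ L y * ad ℝ L k)) =
      ad ℝ L k * (M * ad ℝ L x * ad ℝ L y) - (M * ad ℝ L x * ad ℝ L y) * ad ℝ L k := by
    have := hM.comm k hk
    rw [← mul_assoc (ad ℝ L k), ← mul_assoc (ad ℝ L k), ← this]
    noncomm_ring
  rw [h, map_sub, LinearMap.trace_mul_comm, sub_self]

/-- Schur's argument: an eigenspace of this `𝔨`-invariant symmetric form relative to `B` is a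
nonzero invariant subspace of the irreducible `𝔭`. -/
theorem exists_traceAd_eq (hL : LieAlgebra.IsSimple ℝ L) {M : Module.End ℝ L}
    (hM : f.IsEquivariant M) :
    ∃ μ : ℝ, ∀ x ∈ killingPerp 𝔨, ∀ y ∈ killingPerp 𝔨,
      traceAd M x y = μ * killingForm ℝ L x y := by
  by_cases hne : Nontrivial (killingPerp 𝔨)
  · obtain ⟨μ, v, hv, hμ⟩ := exists_eigenvector (V := killingPerp 𝔨)
      ((killingForm ℝ L).restrict (killingPerp 𝔨)) (fun x y => killingForm_symm _ _)
      (fun x hx => by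
        refine lt_of_le_of_ne (f.killingForm_self_nonneg (hf.P_of_mem x.2)) fun h0 => hx ?_
        exact Subtype.ext (f.eq_zero_of_killingForm_self_nonpos (hf.P_of_mem x.2) h0.symm.le))
      ((traceAd M).restrict (killingPerp 𝔨)) (fun x y => hM.trace_mul_ad_mul_ad _ _)
    let W : Submodule ℝ L :=
      { carrier := {x | x ∈ killingPerp 𝔨 ∧ ∀ y ∈ killingPerp 𝔨,
          traceAd M x y = μ * killingForm ℝ L x y}
        add_mem' := fun ha hb => ⟨add_mem ha.1 hb.1, fun y hy => by
          rw [map_add, LinearMap.add_apply, ha.2 y hy, hb.2 y hy, map_add, LinearMap.add_apply,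
            mul_add]⟩
        zero_mem' := ⟨zero_mem _, by simp⟩
        smul_mem' := fun c a ha => ⟨Submodule.smul_mem _ _ ha.1, fun y hy => by
          rw [map_smul, LinearMap.smul_apply, ha.2 y hy, map_smul, LinearMap.smul_apply,
            smul_eq_mul, smul_eq_mul]; ring⟩ }
    have hW : ∀ x, x ∈ W ↔ x ∈ killingPerp 𝔨 ∧ ∀ y ∈ killingPerp 𝔨,
          traceAd M x y = μ * killingForm ℝ L x y := fun _ => Iff.rfl
    have hle : killingPerp 𝔨 ≤ W := by
      refine hf.killingPerp_le_of_invariant hL (fun x hx => ((hW x).1 hx).1) ?_ ?_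
      · intro h0
        apply hv
        have : (v : L) ∈ W := (hW _).2 ⟨v.2, fun y hy => hμ ⟨y, hy⟩⟩
        rw [h0, Submodule.mem_bot] at this
        exact Subtype.ext this
      · intro k hk w hw
        refine ⟨lie_mem_killingPerp hk hw.1, fun y hy => ?_⟩
        rw [traceAd_lie hM (hf.K_of_mem hk), hw.2 _ (lie_mem_killingPerp hk hy), killingForm_lie']
        ring
    exact ⟨μ, fun x hx => ((hW x).1 (hle hx)).2⟩
  · rw [not_nontrivial_iff_subsingleton] at hne
    refine ⟨0, fun x hx y hy => ?_⟩
    have : x = 0 := congrArg Subtype.val (Subsingleton.elim (⟨x, hx⟩ : killingPerp 𝔨) 0)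
    simp [this]

theorem trace_ad_ad_K {k l : L} (hk : k ∈ 𝔨) (hl : l ∈ 𝔨) :
    trace ℝ L (ad ℝ L k * ad ℝ L l * f.K) = killingForm ℝ 𝔨 ⟨k, hk⟩ ⟨l, hl⟩ := by
  let π : L →ₗ[ℝ] 𝔨 := f.K.codRestrict 𝔨.toSubmodule hf.K_mem
  have h1 : ad ℝ L k * ad ℝ L l * f.K =
      (𝔨.toSubmodule.subtype ∘ₗ (ad ℝ 𝔨 ⟨k, hk⟩ * ad ℝ 𝔨 ⟨l, hl⟩)) ∘ₗ π := by
    ext u; rfl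
  have h2 : π ∘ₗ 𝔨.toSubmodule.subtype = LinearMap.id := by
    ext u
    exact hf.K_of_mem u.2
  rw [h1, LinearMap.trace_comp_comm', ← LinearMap.comp_assoc, h2, LinearMap.id_comp,
    killingForm_apply_apply]
  rfl

/-- The trace over `𝔨` is the Killing form of `𝔨`, whose restriction to an ideal is the Killing form
of that ideal. -/
theorem trace_ad_ad_K_eq_kappa (hneg : ∀ k ∈ 𝔨, k ≠ 0 → killingForm ℝ L k k < 0)
    {i : ι} (hi : IsSummand 𝔨 (𝔨i i)) {k l : L}
    (hk : k ∈ ambient (𝔨i i)) (hl : l ∈ ambient (𝔨i i)) :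
    trace ℝ L (ad ℝ L k * ad ℝ L l * f.K) = kappa (𝔨i i) * killingForm ℝ L k l := by
  rw [hf.trace_ad_ad_K (ambient_le _ hk) (ambient_le _ hl)]
  obtain ⟨k, hk', rfl⟩ := mem_ambient.1 hk
  obtain ⟨l, hl', rfl⟩ := mem_ambient.1 hl
  have h1 := killingForm_eq_kappa hneg hi ⟨k, hk'⟩ ⟨l, hl'⟩
  rw [LieIdeal.killingForm_eq] at h1
  exact h1

theorem trace_ad_ad_K_eq_zero {i j : ι} (hi : IsSummand 𝔨 (𝔨i i)) (hj : IsSummand 𝔨 (𝔨i j))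
    (hij : 𝔨i i ≠ 𝔨i j) {k l : L} (hk : k ∈ ambient (𝔨i i)) (hl : l ∈ ambient (𝔨i j)) :
    trace ℝ L (ad ℝ L k * ad ℝ L l * f.K) = 0 := by
  rw [hf.trace_ad_ad_K (ambient_le _ hk) (ambient_le _ hl)]
  obtain ⟨k, hk', rfl⟩ := mem_ambient.1 hk
  obtain ⟨l, hl', rfl⟩ := mem_ambient.1 hl
  exact IsIdealSummand.orthogonal (killingForm ℝ 𝔨) killingForm_symm killingForm_lie' hi hj hij
    hk' hl'

omit hf in
theorem trace_ad_ad_P (k l : L) :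
    trace ℝ L (ad ℝ L k * ad ℝ L l * f.P) =
      killingForm ℝ L k l - trace ℝ L (ad ℝ L k * ad ℝ L l * f.K) := by
  rw [killingForm_apply_apply, ← Module.End.mul_eq_comp, f.trace_eq (ad ℝ L k * ad ℝ L l)]
  ring

/-- The Schur constant `μ` is found by contraction. Summing over the frame of `𝔭` gives `n μ`.
Exchanging the sums gives `-∑ tr_𝔭 (ad c)²` over the frame of `𝔨ᵢ`, where each term contributes `1 -
κᵢ` because `B(c, c) = -1`. -/
theorem traceAd_proj (hL : LieAlgebra.IsSimple ℝ L)
    (hneg : ∀ k ∈ 𝔨, k ≠ 0 → killingForm ℝ L k k < 0)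
    {i : ι} (hi : IsSummand 𝔨 (𝔨i i)) {x y : L} (hx : x ∈ killingPerp 𝔨)
    (hy : y ∈ killingPerp 𝔨) :
    traceAd (f.proj i) x y =
      (Fintype.card (m i) * (1 - kappa (𝔨i i)) / Fintype.card n) * killingForm ℝ L x y := by
  obtain ⟨μ, hμ⟩ := hf.exists_traceAd_eq hL (hf.isEquivariant_proj i)
  have h1 : ∑ a, traceAd (f.proj i) (f.e a) (f.e a) = Fintype.card n * μ := by
    simp [hμ _ (hf.e_mem _) _ (hf.e_mem _), f.e_e_self]
  have h2 : ∑ b, trace ℝ L (ad ℝ L (f.c ⟨i, b⟩) * ad ℝ L (f.c ⟨i, b⟩) * f.P) =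
      - (Fintype.card (m i) * (1 - kappa (𝔨i i))) := by
    simp only [trace_ad_ad_P, hf.trace_ad_ad_K_eq_kappa hneg hi (hf.c_mem i _) (hf.c_mem i _),
      f.c_c_self]
    simp
    ring
  have h3 : ∀ a, traceAd (f.proj i) (f.e a) (f.e a) =
      - ∑ b, killingForm ℝ L ⁅f.c ⟨i, b⟩, ⁅f.c ⟨i, b⟩, f.e a⁆⁆ (f.e a) := by
    intro a
    have h4 : f.proj i * ad ℝ L (f.e a) * ad ℝ L (f.e a) = -∑ b,
      (killingForm ℝ L (f.c ⟨i, b⟩) ∘ₗ ad ℝ L (f.e a) ∘ₗ ad ℝ L (f.e a)).smulRight (f.c ⟨i, b⟩) := by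
      ext u
      simp [proj_apply]
    rw [traceAd_apply, h4, map_neg, map_sum]
    congr 1
    refine Finset.sum_congr rfl fun b _ => ?_
    rw [LinearMap.trace_smulRight]
    simp only [LinearMap.comp_apply, LieAlgebra.ad_apply]
    rw [← lie_skew (f.e a) (f.c _), lie_neg, map_neg, ← killingForm_lie]
    exact (killingForm_lie' _ _ _).symm
  have h5 : (Fintype.card n : ℝ) * μ = Fintype.card (m i) * (1 - kappa (𝔨i i)) := by
    rw [← h1]
    simp only [h3, Finset.sum_neg_distrib]
    rw [Finset.sum_comm, ← neg_eq_iff_eq_neg.2 h2.symm.symm]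
    simp only [trace_mul_P]
    rfl
  -- For `n = 0` the quotient is a division by zero, but then `𝔭 = 0` and both sides vanish.
  by_cases hn : IsEmpty n
  · have : x = 0 := by rw [← hf.P_of_mem hx, P_apply]; simp
    simp [this]
  · rw [not_isEmpty_iff] at hn
    have hn0 : (Fintype.card n : ℝ) ≠ 0 := by simp
    rw [hμ x hx y hy, ← h5]
    field_simp

end KillingFrame.IsAdapted

end

/-! ### Assembly of the Ricci formulas -/

open KillingFrame KillingFrame.IsAdapted

section
variable {L : Type*} [LieRing L] [LieAlgebra ℝ L] {𝔨 : LieSubalgebra ℝ L}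

theorem formQ_p (hc : IsCompl (killingPerp 𝔨) 𝔨.toSubmodule) {x y : L}
    (hx : x ∈ killingPerp 𝔨) (hy : y ∈ killingPerp 𝔨) : formQ 𝔨 x y = killingForm ℝ L x y := by
  rw [formQ, dif_pos hc]
  simp only [LinearMap.sub_apply, LinearMap.compl₁₂_apply]
  rw [Submodule.projection_apply_of_mem_left hc hx, Submodule.projection_apply_of_mem_left hc hy,
    Submodule.projection_apply_of_mem_right hc.symm hx]
  simp

theorem formQ_k (hc : IsCompl (killingPerp 𝔨) 𝔨.toSubmodule) {x y : L}
    (hx : x ∈ 𝔨) (hy : y ∈ 𝔨) : formQ 𝔨 x y = - killingForm ℝ L x y := by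
  rw [formQ, dif_pos hc]
  simp only [LinearMap.sub_apply, LinearMap.compl₁₂_apply]
  rw [Submodule.projection_apply_of_mem_left hc.symm hx,
    Submodule.projection_apply_of_mem_left hc.symm hy,
    Submodule.projection_apply_of_mem_right hc hx]
  simp

variable [Module.Finite ℝ L]

/-- If the restriction of `Q` to `𝔭` is non-degenerate, then `L = 𝔭 ⊕ 𝔨`. -/
theorem isCompl_of_formQ_ne_zero
    (hp : ∀ x ∈ killingPerp 𝔨, x ≠ 0 → formQ 𝔨 x x ≠ 0) :
    IsCompl (killingPerp 𝔨) 𝔨.toSubmodule := by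
  by_contra hc
  -- Without complementarity `formQ` takes its default value `0`, so the hypothesis forces `𝔭 = 0`;
  -- a dimension count then gives `𝔨 = L`, which is complementary after all.
  have hbot : killingPerp 𝔨 = ⊥ := by
    rw [eq_bot_iff]
    intro x hx
    by_contra h0
    apply hp x hx h0
    rw [formQ, dif_neg hc]
    simp
  have hrefl : (killingForm ℝ L).IsRefl := fun x y hxy => by rw [killingForm_symm, hxy]
  have h1 := LinearMap.BilinForm.finrank_add_finrank_orthogonal hrefl 𝔨.toSubmodule
  rw [show (killingForm ℝ L).orthogonal 𝔨.toSubmodule = ⊥ from hbot, finrank_bot, add_zero] at h1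
  have h2 : 𝔨.toSubmodule = ⊤ := by
    apply Submodule.eq_top_of_finrank_eq
    exact le_antisymm (Submodule.finrank_le _) (by omega)
  apply hc
  rw [hbot, h2]
  exact isCompl_bot_top

variable {ι : Type*} [Fintype ι]

/-- The Ricci curvature in terms of the Lie algebra, for a form `g` on `L` which is diagonal for
the decomposition `L = 𝔭 ⊕ ⨁ᵢ 𝔨ᵢ`, and its Levi-Civita product `V`. -/
theorem trace_curvature (hL : LieAlgebra.IsSimple ℝ L) (𝔨i : ι → LieIdeal ℝ 𝔨)
    (h𝔨i_inj : Function.Injective 𝔨i)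
    (h𝔨i : ∀ I : LieIdeal ℝ 𝔨, I ∈ Set.range 𝔨i ↔ IsSummand 𝔨 I)
    (g : LinearMap.BilinForm ℝ L) (hgs : ∀ x y, g x y = g y x) (hgp : ∀ x, x ≠ 0 → 0 < g x x)
    (β : ℝ) (hβ : 0 < β) (α : ι → ℝ) (hα : ∀ i, 0 < α i)
    (on_p : ∀ X ∈ killingPerp 𝔨, ∀ Y ∈ killingPerp 𝔨, g X Y = β * formQ 𝔨 X Y)
    (on_k : ∀ i, ∀ X ∈ ambient (𝔨i i), ∀ Y ∈ ambient (𝔨i i), g X Y = α i * formQ 𝔨 X Y)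
    (p_k : ∀ i, ∀ X ∈ killingPerp 𝔨, ∀ Y ∈ ambient (𝔨i i), g X Y = 0)
    (k_k : ∀ i j, i ≠ j → ∀ X ∈ ambient (𝔨i i), ∀ Y ∈ ambient (𝔨i j), g X Y = 0)
    (V : L → L → L) (hV : ∀ X Y, V X Y - V Y X = ⁅X, Y⁆)
    (hVg : ∀ X Y Z, g (V X Y) Z = - g Y (V X Z)) :
    ∃ R : L → L → Module.End ℝ L,
      (∀ X Y Z, R X Y Z = V Z (V X Y) - V X (V Z Y) - V ⁅Z, X⁆ Y) ∧
      (∀ X ∈ killingPerp 𝔨, ∀ Y ∈ killingPerp 𝔨,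
        trace ℝ L (R X Y) =
          -(∑ i, (α i / (2 * β) + 1) *
            ((Module.finrank ℝ (𝔨i i) : ℝ) * (1 - kappa (𝔨i i)) /
              (Module.finrank ℝ (killingPerp 𝔨) : ℝ))) * formQ 𝔨 X Y) ∧
      (∀ j, ∀ X ∈ ambient (𝔨i j), ∀ Y ∈ ambient (𝔨i j),
        trace ℝ L (R X Y) =
          1 / 4 * (α j ^ 2 / β ^ 2 * (1 - kappa (𝔨i j)) + kappa (𝔨i j)) * formQ 𝔨 X Y) ∧
      (∀ j, ∀ X ∈ killingPerp 𝔨, ∀ Y ∈ ambient (𝔨i j),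
        trace ℝ L (R X Y) = 0 ∧ trace ℝ L (R Y X) = 0) ∧
      (∀ j k, j ≠ k → ∀ X ∈ ambient (𝔨i j), ∀ Y ∈ ambient (𝔨i k), trace ℝ L (R X Y) = 0) := by
  have hsum : ∀ i, IsSummand 𝔨 (𝔨i i) := fun i => (h𝔨i _).1 ⟨i, rfl⟩
  have hQ : ∀ x ∈ killingPerp 𝔨, x ≠ 0 → 0 < formQ 𝔨 x x := fun x hx hx0 =>
    pos_of_mul_pos_right (on_p x hx x hx ▸ hgp x hx0) hβ.le
  have hc : IsCompl (killingPerp 𝔨) 𝔨.toSubmodule :=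
    isCompl_of_formQ_ne_zero fun x hx hx0 => (hQ x hx hx0).ne'
  have hp : ∀ x ∈ killingPerp 𝔨, x ≠ 0 → 0 < killingForm ℝ L x x := fun x hx hx0 =>
    formQ_p hc hx hx ▸ hQ x hx hx0
  have hneg : ∀ k ∈ 𝔨, k ≠ 0 → killingForm ℝ L k k < 0 := by
    intro k hk hk0
    refine killingForm_neg_of_summands hL hc hp (fun I hI x hx hx0 => ?_) hk hk0
    obtain ⟨i, rfl⟩ := (h𝔨i I).2 hI
    have h1 := pos_of_mul_pos_right (on_k i x hx x hx ▸ hgp x hx0) (hα i).le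
    rw [formQ_k hc (ambient_le _ hx) (ambient_le _ hx)] at h1
    linarith
  obtain ⟨f, he, hcm⟩ := exists_killingFrame hneg 𝔨i h𝔨i_inj h𝔨i hc hp
  have hf : f.IsAdapted 𝔨i := ⟨he, hcm, fun i j hij x hx y hy =>
    killingForm_ambient_eq_zero (hsum i) (hsum j) (h𝔨i_inj.ne hij) hx hy⟩
  -- The weight is chosen so that `-2β B(M·, ·)` equals `-αᵢ B = αᵢ Q` on `𝔨ᵢ`.
  set M := f.scaling (fun i => α i / (2 * β)) with hMdef
  have hM : f.IsEquivariant M := hf.isEquivariant_scaling _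
  have hg : ∀ X Y, g X Y = β * (killingForm ℝ L (f.P X) (f.P Y) - 2 * killingForm ℝ L (M X) Y) := by
    let g' : LinearMap.BilinForm ℝ L :=
      β • ((killingForm ℝ L).compl₁₂ f.P f.P - (2 : ℝ) • killingForm ℝ L ∘ₗ M)
    have hg' : ∀ X Y, g' X Y =
        β * (killingForm ℝ L (f.P X) (f.P Y) - 2 * killingForm ℝ L (M X) Y) := fun X Y => by
      simp [g']
    have : g = g' := by
      apply f.hom_ext
      · intro a
        apply f.hom_ext
        · intro b
          rw [on_p _ (he a) _ (he b), hg', formQ_p hc (he a) (he b), hM.apply_p (f.P_e a),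
            P_e, P_e]
          simp
        · rintro ⟨i, b⟩
          rw [p_k i _ (he a) _ (hcm i b), hg', hM.apply_p (f.P_e a), P_c]
          simp
      · rintro ⟨i, a⟩
        apply f.hom_ext
        · intro b
          rw [hgs, p_k i _ (he b) _ (hcm i a), hg', hM.symm, hM.apply_p (f.P_e b), P_c]
          simp
        · rintro ⟨j, b⟩
          rw [hg', P_c, hMdef, hf.scaling_self _ (hcm i a)]
          by_cases hij : i = j
          · subst hij
            rw [on_k i _ (hcm i a) _ (hcm i b),
              formQ_k hc (ambient_le _ (hcm i a)) (ambient_le _ (hcm i b))]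
            simp
            field_simp
          · rw [k_k i j hij _ (hcm i a) _ (hcm j b), map_smul, LinearMap.smul_apply,
              hf.orthogonal i j hij _ (hcm i a) _ (hcm j b)]
            simp
    rw [this]
    exact hg'
  -- Both products are torsion-free and metric for `g`, so their difference is symmetric and skew,
  -- hence zero.
  have hVU : ∀ X Y, V X Y = f.U M X Y := by
    intro X Y
    rw [← sub_eq_zero]
    refine eq_zero_of_symm_of_skew g hgs hgp (fun X Y => V X Y - f.U M X Y) (fun A B => ?_)
      (fun A B C => ?_) X Y
    · rw [sub_eq_sub_iff_sub_eq_sub, hV, f.U_sub_U]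
    · have h1 := U_skew hM A B C
      have h2 : g (f.U M A B) C = - g B (f.U M A C) := by
        rw [hg, hg, h1]; ring
      rw [map_sub, map_sub, LinearMap.sub_apply, hVg, h2]
      ring
  refine ⟨f.riem M, fun X Y Z => ?_, ?_, ?_, ?_, ?_⟩
  · simp only [hVU, riem_apply]
  · intro X hX Y hY
    rw [trace_riem_pp hM (hf.P_of_mem hX) (hf.P_of_mem hY), formQ_p hc hX hY]
    have h1 : f.K + M = ∑ i, (α i / (2 * β) + 1) • f.proj i := by
      rw [hMdef, KillingFrame.IsAdapted.K_eq_sum_proj, KillingFrame.scaling,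
        ← Finset.sum_add_distrib]
      exact Finset.sum_congr rfl fun i _ => by rw [add_smul, one_smul, add_comm]
    have h2 : trace ℝ L ((f.K + M) * ad ℝ L Y * ad ℝ L X) =
        ∑ i, (α i / (2 * β) + 1) * KillingFrame.IsAdapted.traceAd (f.proj i) Y X := by
      simp only [h1, Finset.sum_mul, map_sum, smul_mul_assoc, map_smul, smul_eq_mul]
      rfl
    rw [h2, neg_mul, Finset.sum_mul]
    congr 1
    refine Finset.sum_congr rfl fun i _ => ?_
    rw [hf.traceAd_proj hL hneg (hsum i) hY hX, Fintype.card_fin, Fintype.card_fin,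
      killingForm_symm]
    ring
  · intro j X hX Y hY
    have hXk := ambient_le _ hX
    have hYk := ambient_le _ hY
    -- The value is `-(αⱼ / (2β))² (1 - κⱼ) B - (κⱼ / 4) B`, and `B = -Q` on `𝔨`.
    rw [trace_riem_kk hM (hf.K_of_mem hXk) (hf.K_of_mem hYk),
      KillingFrame.IsAdapted.trace_ad_ad_P, hMdef, hf.scaling_self _ hX, hf.scaling_self _ hY,
      hf.trace_ad_ad_K_eq_kappa hneg (hsum j) (Submodule.smul_mem _ _ hX)
        (Submodule.smul_mem _ _ hY), hf.trace_ad_ad_K_eq_kappa hneg (hsum j) hX hY,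
      formQ_k hc hXk hYk]
    simp only [map_smul, LinearMap.smul_apply, smul_eq_mul]
    field_simp
    ring
  · intro j X hX Y hY
    exact ⟨trace_riem_pk hM (hf.P_of_mem hX) (hf.K_of_mem (ambient_le _ hY)),
      trace_riem_kp hM (hf.P_of_mem hX) (hf.K_of_mem (ambient_le _ hY))⟩
  · intro j k hjk X hX Y hY
    rw [trace_riem_kk hM (hf.K_of_mem (ambient_le _ hX)) (hf.K_of_mem (ambient_le _ hY)),
      KillingFrame.IsAdapted.trace_ad_ad_P, hMdef, hf.scaling_self _ hX, hf.scaling_self _ hY,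
      hf.trace_ad_ad_K_eq_zero (hsum j) (hsum k) (h𝔨i_inj.ne hjk) (Submodule.smul_mem _ _ hX)
        (Submodule.smul_mem _ _ hY),
      hf.trace_ad_ad_K_eq_zero (hsum j) (hsum k) (h𝔨i_inj.ne hjk) hX hY]
    simp only [map_smul, LinearMap.smul_apply, hf.orthogonal j k hjk _ hX _ hY]
    simp

end

end RicciNatRed

end

open RicciNatRed in
theorem mainTheorem4
    {E : Type*} [NormedAddCommGroup E] [NormedSpace ℝ E] [FiniteDimensional ℝ E]
    {G : Type*} [TopologicalSpace G] [ChartedSpace E G] [Group G] [LieGroup 𝓘(ℝ, E) ∞ G]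
    [ConnectedSpace G] [NoncompactSpace G]
    (hG : LieAlgebra.IsSimple ℝ (GroupLieAlgebra 𝓘(ℝ, E) G))
    (K : Subgroup G) (hK : Maximal (fun H : Subgroup G => IsCompact (H : Set G)) K)
    (𝔨 : LieSubalgebra ℝ (GroupLieAlgebra 𝓘(ℝ, E) G))
    (h𝔨 : (𝔨 : Set (GroupLieAlgebra 𝓘(ℝ, E) G)) = lieAlgebraSet E K)
    {ι : Type*} [Fintype ι] (𝔨i : ι → LieIdeal ℝ 𝔨)
    (h𝔨i_inj : Function.Injective 𝔨i)
    (h𝔨i : ∀ I : LieIdeal ℝ 𝔨, I ∈ Set.range 𝔨i ↔ IsSummand 𝔨 I)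
    (g : Metric E G) (hg_inv : IsLeftInvariant g)
    (β : ℝ) (hβ : 0 < β) (α : ι → ℝ) (hα : ∀ i, 0 < α i)
    (hg : IsDiagonal g 𝔨 𝔨i β α)
    (cov : Connection E G) (hcov : IsLeviCivita g cov) :
    (∀ X ∈ killingPerp 𝔨, ∀ Y ∈ killingPerp 𝔨,
      ricci cov X Y =
        -(∑ i, (α i / (2 * β) + 1) *
          ((Module.finrank ℝ (𝔨i i) : ℝ) * (1 - kappa (𝔨i i)) /
            (Module.finrank ℝ (killingPerp 𝔨) : ℝ))) * formQ 𝔨 X Y) ∧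
    (∀ j, ∀ X ∈ ambient (𝔨i j), ∀ Y ∈ ambient (𝔨i j),
      ricci cov X Y =
        1 / 4 * (α j ^ 2 / β ^ 2 * (1 - kappa (𝔨i j)) + kappa (𝔨i j)) * formQ 𝔨 X Y) ∧
    (∀ j, ∀ X ∈ killingPerp 𝔨, ∀ Y ∈ ambient (𝔨i j),
      ricci cov X Y = 0 ∧ ricci cov Y X = 0) ∧
    (∀ j k, j ≠ k → ∀ X ∈ ambient (𝔨i j), ∀ Y ∈ ambient (𝔨i k), ricci cov X Y = 0) := by
  obtain ⟨V, hV1, hV2, hV3⟩ := exists_leviCivita_algebraic g hg_inv cov hcov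
  obtain ⟨R, hR, h1, h2, h3, h4⟩ := trace_curvature hG 𝔨i h𝔨i_inj h𝔨i (metricForm g)
    (fun x y => g.symm 1 x y) (fun x hx => g.pos 1 x hx) β hβ α hα hg.on_p hg.on_k hg.p_k hg.k_k
    V hV2 hV3
  have hric : ∀ X Y, ricci cov X Y = LinearMap.trace ℝ _ (R X Y) := by
    intro X Y
    rw [ricci_eq_sum cov V hV1, LinearMap.trace_eq_matrix_trace ℝ
      (Module.finBasis ℝ (GroupLieAlgebra 𝓘(ℝ, E) G)), Matrix.trace]
    refine Finset.sum_congr rfl fun i _ => ?_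
    rw [Matrix.diag_apply, LinearMap.toMatrix_apply, hR]
  simp only [hric]
  exact ⟨h1, h2, h3, h4⟩
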